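/- Let $S=\{s_1,\dots,s_n\}$ be a finite set of distinct points of the Euclidean plane, with elevations $z_1,\dots,z_n$ in $\mathbb R$ or $\mathbb C$. "Circle" includes straight lines (circles through infinity). A circle is called empty on one side if one of the two open regions that it bounds (an open disk and its exterior, or two open half-planes) contains no point of $S$. Let $s\notin S$. The point $s_i$ is an extended Voronoi neighbor of $s$ if some circle through $s$ and $s_i$ is empty on one side. In that case the exterior lune angle $\theta_i=\theta_i(s)\in[0,\pi]$ is the angle between the two extreme (maximal) empty circles through $s$ and $s_i$, that is, the supremum of the angles between the unit normals at $s$, pointing into the empty side, of two circles through $s$ and $s_i$ that are empty on one side. Put $W=\sum_i\tan(\theta_i/2)$, $w_i=\tan(\theta_i/2)/W$, and $$f(s)=\sum_i w_i z_i ,$$ the sums being over the extended Voronoi neighbors $s_i$ of $s$; and put $f(s_i)=z_i$ for $i=1,\dots,n$. **Theorem.** 1. Suppose that $S$ is not contained in a line. At every point $s$ of the convex hull $\operatorname{conv}(S)$ outside $S$ the weights are well defined: $0\le\theta_i<\pi$ for all $i$, and $W>0$. The function $f$ is continuous on $\operatorname{conv}(S)$ and interpolates the elevations: $f(s_i)=z_i$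 for every $i$, and $\sum_j w_j(s)z_j\to z_i$ as $s\to s_i$ with $s\in\operatorname{conv}(S)\setminus S$. 2. Let $C$ be a circle of positive finite radius, and let $h$ be a real- or complex-valued function that is continuous on the closed disk bounded by $C$ and harmonic in its interior. Let $s$ be a point interior to $C$. For every $\delta>0$ there is an $\varepsilon>0$ such that for every finite nonempty set $S=\{s_1,\dots,s_n\}\subset C$ of distinct points for which the maximum angle of arc between successive points of $S$ is less than $\varepsilon$, the point $s$ lies in $\operatorname{conv}(S)$, and the interpolant $f$ of the elevations $z_i=h(s_i)$ satisfies $|f(s)-h(s)|<\delta$. -/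

import Mathlib

noncomputable section

namespace MobiusInterp

/-! The Euclidean plane is `ℂ`. The sample points are a family `p : Fin n → ℂ`, the elevations a
family `z : Fin n → 𝕜` with `𝕜 = ℝ` or `𝕜 = ℂ`. -/

/-- The open generalized disk whose boundary passes through `s`, with inner unit normal `u` at `s`
and signed curvature `κ`. It is an open disk if `0 < κ`, an open half-plane if `κ = 0` (a line is a
circle through infinity), and the complement of a closed disk if `κ < 0`: see `genDisk_of_pos`,
`genDisk_zero` and `genDisk_of_neg`. -/
def genDisk (s u : ℂ) (κ : ℝ) : Set ℂ :=
  {x | κ * ‖x - s‖ ^ 2 < 2 * inner ℝ u (x - s)}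

/-- The circle (or line) that bounds `genDisk s u κ`. It always contains `s`. -/
def genCircle (s u : ℂ) (κ : ℝ) : Set ℂ :=
  {x | κ * ‖x - s‖ ^ 2 = 2 * inner ℝ u (x - s)}

theorem dist_sq_center {s u : ℂ} {κ : ℝ} (hu : ‖u‖ = 1) (hκ : κ ≠ 0) (x : ℂ) :
    dist x (s + κ⁻¹ • u) ^ 2
      = κ⁻¹ ^ 2 + κ⁻¹ * (κ * ‖x - s‖ ^ 2 - 2 * inner ℝ u (x - s)) := by
  have h : x - (s + κ⁻¹ • u) = (x - s) - κ⁻¹ • u := by ring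
  rw [dist_eq_norm, h, norm_sub_sq_real, norm_smul, hu, inner_smul_right,
    real_inner_comm, Real.norm_eq_abs, mul_one, sq_abs]
  field_simp
  ring

theorem genDisk_of_pos {s u : ℂ} {κ : ℝ} (hu : ‖u‖ = 1) (hκ : 0 < κ) :
    genDisk s u κ = Metric.ball (s + κ⁻¹ • u) κ⁻¹ := by
  ext x
  have h := dist_sq_center (s := s) hu hκ.ne' x
  have hi : 0 < κ⁻¹ := inv_pos.mpr hκ
  rw [Metric.mem_ball, ← sq_lt_sq₀ dist_nonneg hi.le, h, add_lt_iff_neg_left]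
  change κ * ‖x - s‖ ^ 2 < 2 * inner ℝ u (x - s) ↔ _
  constructor <;> intro hx <;> nlinarith

theorem genDisk_zero (s u : ℂ) : genDisk s u 0 = {x | 0 < inner ℝ u (x - s)} := by
  ext x
  simp [genDisk]

theorem genDisk_of_neg {s u : ℂ} {κ : ℝ} (hu : ‖u‖ = 1) (hκ : κ < 0) :
    genDisk s u κ = (Metric.closedBall (s + κ⁻¹ • u) (-κ⁻¹))ᶜ := by
  ext x
  have h := dist_sq_center (s := s) hu hκ.ne x
  have hi : κ⁻¹ < 0 := inv_neg''.mpr hκ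
  rw [Set.mem_compl_iff, Metric.mem_closedBall, not_le,
    ← sq_lt_sq₀ (neg_pos.mpr hi).le dist_nonneg, h, neg_sq, lt_add_iff_pos_right]
  change κ * ‖x - s‖ ^ 2 < 2 * inner ℝ u (x - s) ↔ _
  constructor <;> intro hx <;> nlinarith

variable {n : ℕ}

/-- The inner unit normals at `s` of the circles (or lines) through `s` and the sample `p i` that
bound an empty disk, disk complement or half-plane. Since such a circle is determined by `s`, `p i`
and its normal at `s`, this set parametrizes all the empty circles through `s` and `p i`. -/
def emptyNormals (p : Fin n → ℂ) (s : ℂ) (i : Fin n) : Set ℂ :=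
  {u | ‖u‖ = 1 ∧ ∃ κ : ℝ, p i ∈ genCircle s u κ ∧ ∀ j, p j ∉ genDisk s u κ}

/-- `p i` is an extended Voronoi neighbor of `s`: some circle through both of them bounds an empty
disk or an empty disk complement (or is a line bounding an empty half-plane). -/
def IsExtNeighbor (p : Fin n → ℂ) (s : ℂ) (i : Fin n) : Prop :=
  (emptyNormals p s i).Nonempty

/-- The exterior lune angle `θ_i` between `s` and `p i`: the angle between the two maximal (extreme)
empty circles through `s` and `p i`, that is, the largest angle at `s` between the inner normals of
two empty disks through `s` and `p i`. It is `π` minus the interior angle at `s` of the lune in which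
the two extreme disks meet. -/
def luneAngle (p : Fin n → ℂ) (s : ℂ) (i : Fin n) : ℝ :=
  sSup {θ | ∃ u ∈ emptyNormals p s i, ∃ v ∈ emptyNormals p s i, θ = InnerProductGeometry.angle u v}

open Classical in
/-- The finite set of (indices of) extended neighbors of `s`. -/
def extNeighbors (p : Fin n → ℂ) (s : ℂ) : Finset (Fin n) :=
  Finset.univ.filter (IsExtNeighbor p s)

/-- The normalizing constant `W = ∑ tan (θ_i / 2)`. -/
def totalWeight (p : Fin n → ℂ) (s : ℂ) : ℝ :=
  ∑ i ∈ extNeighbors p s, Real.tan (luneAngle p s i / 2)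

/-- The weight `w_i = tan (θ_i / 2) / W`. -/
def weight (p : Fin n → ℂ) (s : ℂ) (i : Fin n) : ℝ :=
  Real.tan (luneAngle p s i / 2) / totalWeight p s

/-- The weighted average `∑ w_i z_i` over the extended neighbors of `s`; meant for `s` that is not a
sample point. -/
def neighborAverage {𝕜 : Type*} [RCLike 𝕜] (p : Fin n → ℂ) (z : Fin n → 𝕜) (s : ℂ) : 𝕜 :=
  ∑ i ∈ extNeighbors p s, weight p s i • z i

open Classical in
/-- The interpolant: the weighted average at points that are not samples, and the elevation `z i` at
the sample `p i`, where `θ_i` reaches `π` and `tan (θ_i / 2)` is infinite. -/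
def interpolant {𝕜 : Type*} [RCLike 𝕜] (p : Fin n → ℂ) (z : Fin n → 𝕜) (s : ℂ) : 𝕜 :=
  if h : ∃ i, p i = s then z h.choose else neighborAverage p z s

/-- The counterclockwise angle in `(0, 2π]` from `a` to `b` around `c`. -/
def ccwAngle (c a b : ℂ) : ℝ :=
  toIocMod Real.two_pi_pos 0 (Complex.arg ((b - c) / (a - c)))

/-- For samples on a circle centered at `c`: the maximum angle of arc between a sample and its
successor in counterclockwise order. -/
def maxGap (c : ℂ) (p : Fin n → ℂ) : ℝ :=
  ⨆ i, ⨅ j, ccwAngle c (p i) (p j)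

end MobiusInterp

end

namespace MobiusInterp

open Complex Filter Topology MeasureTheory Set InnerProductGeometry
open scoped Real

/-! ### Normal cones of a finite planar configuration -/

/-! Invert about `s` and let `Q j` be the image of `p j`. A circle through `s` with inner normal `u`
becomes a line orthogonal to `u`. It is empty on its inner side iff the `Q j` all lie on the other
side. Hence the empty circles through `s` and `p i` are the supporting lines of the hull of `Q` at
`Q i`, and `θ_i` is the exterior angle there.

This angle is the measure of the directions in which `Q i` is the farthest point
(`integral_normalInd`). Almost every direction has a unique farthest point, so the angles add up to
`2π`, and `x ≤ tan x` gives `W ≥ π`. Dominated convergence makes the angles continuous. An angle `π`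
would put all samples on a circle or line through `s`, which is impossible for `s` in the hull of
noncollinear samples.

As `s` approaches `p i`, `Q i` runs off to infinity, so `θ_i → π` and `tan (θ_i / 2) → ∞`. The other
angles stay away from `π` (`exists_luneAngle_bound`), so all the weight goes to `z i`.

For samples on a circle `C` around `s`, the inverted samples lie on a circle, and `u` is normal at
`Q i` iff `Q i` is the inverted sample nearest to the point of that circle in direction `u`. Undoing
the inversion sends that point to `diskMap c s R u`, where `diskMap` is a conformal map of disks
taking `0` to `s`. Thus `∑ θ_i h(p i)` is a Riemann sum for the integral of `h ∘ diskMap` over the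
unit circle, which is `2π h(s)` by the mean value property. For dense samples the angles are small
and `tan (θ_i / 2)` may be replaced by `θ_i / 2`. -/

/-- The cone of outer normals at `Q i` of the convex hull of the points `Q j`. -/
def normalCone {ι : Type*} (Q : ι → ℂ) (i : ι) : Set ℂ :=
  {u | ∀ j, inner ℝ u (Q j) ≤ inner ℝ u (Q i)}

/-- The unit outer normals at `Q i`. -/
def unitNormals {ι : Type*} (Q : ι → ℂ) (i : ι) : Set ℂ :=
  {u | ‖u‖ = 1 ∧ u ∈ normalCone Q i}

/-- The exterior angle at `Q i` of the convex hull of the points `Q j`. -/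
noncomputable def extAngle {ι : Type*} (Q : ι → ℂ) (i : ι) : ℝ :=
  sSup {θ | ∃ u ∈ unitNormals Q i, ∃ v ∈ unitNormals Q i, θ = angle u v}

/-- The inversion in the unit circle about `s`, translated so that `s` becomes the origin. -/
noncomputable def invert (s x : ℂ) : ℂ := (‖x - s‖ ^ 2)⁻¹ • (x - s)

/-- The unit vector in direction `t`. -/
noncomputable def dir (t : ℝ) : ℂ := Complex.exp (t * I)

section Cone

variable {ι : Type*} {Q : ι → ℂ} {i : ι}

theorem isClosed_normalCone (Q : ι → ℂ) (i : ι) : IsClosed (normalCone Q i) := by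
  simp only [normalCone, ofPred_forall]
  exact isClosed_iInter fun j => isClosed_le (by fun_prop) (by fun_prop)

theorem normalCone_combination {u v w : ℂ} {a b c : ℝ} (ha : 0 ≤ a) (hb : 0 ≤ b) (hc : 0 < c)
    (hu : u ∈ normalCone Q i) (hv : v ∈ normalCone Q i) (h : c • w = a • u + b • v) :
    w ∈ normalCone Q i := by
  intro j
  have key : ∀ x, c * inner ℝ w x = a * inner ℝ u x + b * inner ℝ v x := fun x => by
    rw [← real_inner_smul_left, h, inner_add_left, real_inner_smul_left, real_inner_smul_left]
  refine le_of_mul_le_mul_left ?_ hc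
  rw [key, key]
  exact add_le_add (mul_le_mul_of_nonneg_left (hu j) ha) (mul_le_mul_of_nonneg_left (hv j) hb)

theorem isCompact_unitNormals (Q : ι → ℂ) (i : ι) : IsCompact (unitNormals Q i) := by
  have : unitNormals Q i = Metric.sphere 0 1 ∩ normalCone Q i := by
    ext u; simp [unitNormals]
  rw [this]
  exact (isCompact_sphere _ _).inter_right (isClosed_normalCone Q i)

theorem ne_zero_of_norm_eq_one {u : ℂ} (h : ‖u‖ = 1) : u ≠ 0 := by
  rintro rfl; simp at h

theorem extAngle_nonneg (Q : ι → ℂ) (i : ι) : 0 ≤ extAngle Q i :=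
  Real.sSup_nonneg (by rintro _ ⟨u, -, v, -, rfl⟩; exact angle_nonneg u v)

theorem angle_le_extAngle {u v : ℂ} (hu : u ∈ unitNormals Q i) (hv : v ∈ unitNormals Q i) :
    angle u v ≤ extAngle Q i :=
  le_csSup ⟨π, by rintro _ ⟨u, -, v, -, rfl⟩; exact angle_le_pi u v⟩ ⟨u, hu, v, hv, rfl⟩

theorem extAngle_le {b : ℝ} (hb : 0 ≤ b)
    (h : ∀ u ∈ unitNormals Q i, ∀ v ∈ unitNormals Q i, angle u v ≤ b) : extAngle Q i ≤ b :=
  Real.sSup_le (by rintro _ ⟨u, hu, v, hv, rfl⟩; exact h u hu v hv) hb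

theorem exists_angle_eq_extAngle (h : (unitNormals Q i).Nonempty) :
    ∃ u ∈ unitNormals Q i, ∃ v ∈ unitNormals Q i, angle u v = extAngle Q i := by
  have hK := (isCompact_unitNormals Q i).prod (isCompact_unitNormals Q i)
  have hc : ContinuousOn (fun x : ℂ × ℂ => angle x.1 x.2)
      (unitNormals Q i ×ˢ unitNormals Q i) := fun x hx =>
    (continuousAt_angle (ne_zero_of_norm_eq_one hx.1.1)
      (ne_zero_of_norm_eq_one hx.2.1)).continuousWithinAt
  obtain ⟨⟨u, v⟩, hx, hmax⟩ := hK.exists_isMaxOn (h.prod h) hc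
  refine ⟨u, hx.1, v, hx.2, le_antisymm (angle_le_extAngle hx.1 hx.2) ?_⟩
  exact extAngle_le (angle_nonneg _ _) fun a ha b hb => hmax (a := (a, b)) ⟨ha, hb⟩

theorem extAngle_of_empty (h : ¬ (unitNormals Q i).Nonempty) : extAngle Q i = 0 := by
  rw [not_nonempty_iff_eq_empty] at h
  simp [extAngle, h]

/-- The supremum is attained, so an angle `π` yields two opposite normals at `Q i`, and the
functional they define is constant on the configuration. -/
theorem extAngle_lt_pi (hQ : ∀ u : ℂ, u ≠ 0 → ∃ j k, inner ℝ u (Q j) ≠ inner ℝ u (Q k)) :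
    extAngle Q i < π := by
  by_cases h : (unitNormals Q i).Nonempty
  · obtain ⟨u, hu, v, hv, huv⟩ := exists_angle_eq_extAngle h
    rw [← huv]
    refine lt_of_le_of_ne (angle_le_pi u v) fun hpi => ?_
    obtain ⟨hu0, r, hr, rfl⟩ := angle_eq_pi_iff.1 hpi
    have key : ∀ j, inner ℝ u (Q j) = inner ℝ u (Q i) := fun j => by
      have h1 := hu.2 j
      have h2 := hv.2 j
      rw [real_inner_smul_left, real_inner_smul_left] at h2
      nlinarith
    obtain ⟨j, k, hjk⟩ := hQ u hu0
    exact hjk ((key j).trans (key k).symm)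
  · rw [extAngle_of_empty h]; exact Real.pi_pos

end Cone

/-! ### Inversion about `s`: empty circles become supporting lines. -/

section Invert

theorem inner_invert (s x u : ℂ) :
    inner ℝ u (invert s x) = (‖x - s‖ ^ 2)⁻¹ * inner ℝ u (x - s) := by
  rw [invert, real_inner_smul_right]

/-- Dividing the equation of the circle by `‖x - s‖ ^ 2` turns it into `⟪u, invert s x⟫ = κ / 2`.
Passing through `p i` therefore determines `κ`, and emptiness says that `Q i` maximizes the
functional `u`. -/
theorem emptyNormals_eq {n : ℕ} {p : Fin n → ℂ} {s : ℂ} (hs : s ∉ range p) (i : Fin n) :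
    emptyNormals p s i = unitNormals (fun j => invert s (p j)) i := by
  have hpos : ∀ j, 0 < ‖p j - s‖ ^ 2 := fun j =>
    pow_pos (norm_pos_iff.2 (sub_ne_zero.2 fun h => hs ⟨j, h⟩)) 2
  ext u
  simp only [emptyNormals, unitNormals, normalCone, genCircle, genDisk, mem_ofPred_eq, not_lt,
    inner_invert]
  refine and_congr_right fun _ => ⟨?_, fun h => ?_⟩
  · rintro ⟨κ, hi, hj⟩ j
    rw [inv_mul_le_iff₀ (hpos j)]
    have : (‖p i - s‖ ^ 2)⁻¹ * inner ℝ u (p i - s) = κ / 2 := by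
      rw [inv_mul_eq_iff_eq_mul₀ (hpos i).ne']; linarith
    rw [this]; linarith [hj j]
  · refine ⟨2 * ((‖p i - s‖ ^ 2)⁻¹ * inner ℝ u (p i - s)), ?_, fun j => ?_⟩
    · linear_combination (2 * inner ℝ u (p i - s)) * inv_mul_cancel₀ (hpos i).ne'
    · have := (inv_mul_le_iff₀ (hpos j)).1 (h j)
      linarith

theorem luneAngle_eq {n : ℕ} {p : Fin n → ℂ} {s : ℂ} (hs : s ∉ range p) (i : Fin n) :
    luneAngle p s i = extAngle (fun j => invert s (p j)) i := by
  rw [luneAngle, extAngle, emptyNormals_eq hs]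

theorem invert_eq (s x : ℂ) : invert s x = (starRingEnd ℂ (x - s))⁻¹ := by
  rw [invert, Complex.inv_def, Complex.conj_conj, Complex.normSq_conj, Complex.normSq_eq_norm_sq,
    Complex.real_smul]
  push_cast
  ring

theorem invert_sub_invert {s x y : ℂ} (hx : x ≠ s) (hy : y ≠ s) :
    ‖invert s x - invert s y‖ = ‖x - y‖ / (‖x - s‖ * ‖y - s‖) := by
  have hx' : starRingEnd ℂ (x - s) ≠ 0 :=
    (map_ne_zero _).2 (sub_ne_zero.2 hx)
  have hy' : starRingEnd ℂ (y - s) ≠ 0 :=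
    (map_ne_zero _).2 (sub_ne_zero.2 hy)
  rw [invert_eq, invert_eq, inv_sub_inv hx' hy', norm_div, norm_mul, ← map_sub,
    Complex.norm_conj, Complex.norm_conj, Complex.norm_conj, norm_sub_rev x y]
  congr 2; ring

theorem invert_injective_of_ne {s x y : ℂ} (hx : x ≠ s) (hy : y ≠ s)
    (h : invert s x = invert s y) : x = y := by
  have := invert_sub_invert hx hy
  rw [h, sub_self, norm_zero, eq_comm, div_eq_zero_iff] at this
  rcases this with h | h
  · exact sub_eq_zero.1 (norm_eq_zero.1 h)
  · rcases mul_eq_zero.1 h with h | h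
    · exact absurd (sub_eq_zero.1 (norm_eq_zero.1 h)) hx
    · exact absurd (sub_eq_zero.1 (norm_eq_zero.1 h)) hy

end Invert

/-! ### The arc of unit normals -/

@[simp] theorem norm_dir (t : ℝ) : ‖dir t‖ = 1 := Complex.norm_exp_ofReal_mul_I t

@[fun_prop] theorem continuous_dir : Continuous dir := by unfold dir; fun_prop

theorem dir_eq (t : ℝ) : dir t = Real.cos t + Real.sin t * I := by
  rw [dir, Complex.exp_mul_I, Complex.ofReal_cos, Complex.ofReal_sin]

theorem dir_periodic : Function.Periodic dir (2 * π) := fun t => by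
  rw [dir_eq, dir_eq, Real.cos_add_two_pi, Real.sin_add_two_pi]

theorem exists_dir_eq {u : ℂ} (hu : ‖u‖ = 1) : ∃ t, u = dir t :=
  ⟨u.arg, by have := Complex.norm_mul_exp_arg_mul_I u; rw [hu] at this; simpa [dir] using this.symm⟩

theorem angle_dir {x y : ℝ} (h : |x - y| ≤ π) : angle (dir x) (dir y) = |x - y| := by
  rw [dir, dir, Complex.angle_exp_exp]
  obtain ⟨h1, h2⟩ := abs_le.1 h
  rcases h1.eq_or_lt with h1 | h1
  · rw [← h1, abs_neg, ← toIocMod_add_right Real.two_pi_pos,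
      (toIocMod_eq_self _).2 ⟨by linarith [Real.pi_pos], by linarith⟩]
    congr 1; ring
  · rw [(toIocMod_eq_self _).2 ⟨h1, by linarith⟩]

theorem exists_dir_sub {x y : ℝ} :
    ∃ τ, dir x = dir (y + τ) ∧ |τ| = angle (dir x) (dir y) := by
  refine ⟨toIocMod Real.two_pi_pos (-π) (x - y), ?_, ?_⟩
  · have : x = y + toIocMod Real.two_pi_pos (-π) (x - y) +
        toIocDiv Real.two_pi_pos (-π) (x - y) • (2 * π) := by
      rw [add_assoc, toIocMod_add_toIocDiv_zsmul]; ring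
    conv_lhs => rw [this]
    exact dir_periodic.zsmul _ _
  · rw [dir, dir, Complex.angle_exp_exp]

/-- Expresses a direction between `t₀ - a` and `t₀ + a` as a nonnegative combination of these two;
the factor `sin (2 * a)` avoids a division. -/
theorem sin_smul_dir (t₀ a φ : ℝ) :
    Real.sin (2 * a) • dir (t₀ + φ) =
      Real.sin (a + φ) • dir (t₀ + a) + Real.sin (a - φ) • dir (t₀ - a) := by
  simp only [dir_eq, Complex.real_smul]
  apply Complex.ext
  · simp [Real.cos_add, Real.sin_add, Real.cos_sub, Real.sin_sub, Real.sin_two_mul]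
    ring
  · simp [Real.cos_add, Real.sin_add, Real.cos_sub, Real.sin_sub, Real.sin_two_mul]
    ring

/-- The unit normals at `Q i` form an arc of the unit circle whose length is the exterior angle. -/
theorem exists_arc {ι : Type*} {Q : ι → ℂ} {i : ι} (hne : (unitNormals Q i).Nonempty)
    (hπ : extAngle Q i < π) :
    ∃ t₀, ∀ φ ∈ Icc (-π) π, dir (t₀ + φ) ∈ normalCone Q i ↔ |φ| ≤ extAngle Q i / 2 := by
  obtain ⟨u, hu, v, hv, huv⟩ := exists_angle_eq_extAngle hne
  obtain ⟨x, rfl⟩ := exists_dir_eq hu.1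
  obtain ⟨y, rfl⟩ := exists_dir_eq hv.1
  obtain ⟨τ, hτ, habs⟩ := exists_dir_sub (x := x) (y := y)
  rw [huv] at habs
  set θ := extAngle Q i with hθ
  have hθ0 : 0 ≤ θ := extAngle_nonneg Q i
  have hmem : dir ((y + τ / 2) + θ / 2) ∈ normalCone Q i ∧
      dir ((y + τ / 2) - θ / 2) ∈ normalCone Q i := by
    rcases abs_cases τ with ⟨h, -⟩ | ⟨h, -⟩
    · rw [show (y + τ / 2) + θ / 2 = y + τ by linarith, show (y + τ / 2) - θ / 2 = y by linarith,
        ← hτ]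
      exact ⟨hu.2, hv.2⟩
    · rw [show (y + τ / 2) + θ / 2 = y by linarith, show (y + τ / 2) - θ / 2 = y + τ by linarith,
        ← hτ]
      exact ⟨hv.2, hu.2⟩
  obtain ⟨h₁, h₂⟩ := hmem
  generalize y + τ / 2 = t₀ at h₁ h₂
  have hin : ∀ φ, |φ| ≤ θ / 2 → dir (t₀ + φ) ∈ normalCone Q i := fun φ hφ => by
    obtain ⟨ha, hb⟩ := abs_le.1 hφ
    rcases hθ0.eq_or_lt with h0 | h0
    · have : φ = θ / 2 := by linarith
      rw [this]; exact h₁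
    · refine normalCone_combination (Real.sin_nonneg_of_nonneg_of_le_pi ?_ ?_)
        (Real.sin_nonneg_of_nonneg_of_le_pi ?_ ?_) (Real.sin_pos_of_pos_of_lt_pi ?_ ?_) h₁ h₂
        (sin_smul_dir t₀ (θ / 2) φ) <;> linarith
  have hangle : ∀ x y : ℝ, dir x ∈ normalCone Q i → dir y ∈ normalCone Q i → |x - y| ≤ π →
      |x - y| ≤ θ := fun x y hx hy h => by
    rw [← angle_dir h]; exact angle_le_extAngle ⟨norm_dir x, hx⟩ ⟨norm_dir y, hy⟩
  refine ⟨t₀, fun φ hφ => ⟨fun h => ?_, hin φ⟩⟩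
  obtain ⟨hφ1, hφ2⟩ := hφ
  rw [abs_le]
  constructor
  · by_contra! hlt
    rcases le_total (-φ + θ / 2) π with hle | hle
    · have hx : |t₀ + φ - (t₀ + θ / 2)| = -φ + θ / 2 := by
        rw [abs_of_nonpos] <;> linarith
      have := hangle _ _ h h₁ (by rw [hx]; exact hle)
      rw [hx] at this; linarith
    -- The far end of the arc is at least half a turn away, so the antipode of `φ` lies in the arc;
    -- two opposite normals contradict `θ < π`.
    · have h' := hin (φ + π) (by rw [abs_le]; constructor <;> linarith)
      have hx : |t₀ + φ - (t₀ + (φ + π))| = π := by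
        rw [show t₀ + φ - (t₀ + (φ + π)) = -π by ring, abs_neg, abs_of_pos Real.pi_pos]
      have := hangle _ _ h h' hx.le
      rw [hx] at this; linarith
  · by_contra! hlt
    rcases le_total (φ + θ / 2) π with hle | hle
    · have hx : |t₀ + φ - (t₀ - θ / 2)| = φ + θ / 2 := by
        rw [abs_of_nonneg] <;> linarith
      have := hangle _ _ h h₂ (by rw [hx]; exact hle)
      rw [hx] at this; linarith
    · have h' := hin (φ - π) (by rw [abs_le]; constructor <;> linarith)
      have hx : |t₀ + φ - (t₀ + (φ - π))| = π := by
        rw [show t₀ + φ - (t₀ + (φ - π)) = π by ring, abs_of_pos Real.pi_pos]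
      have := hangle _ _ h h' hx.le
      rw [hx] at this; linarith

/-! ### Exterior angles as measures of sets of directions. -/

open Classical in
/-- Indicator function of the set of directions that are normal at `Q i`. -/
noncomputable def normalInd {ι : Type*} (Q : ι → ℂ) (i : ι) (t : ℝ) : ℝ :=
  if dir t ∈ normalCone Q i then 1 else 0

section NormalInd

variable {ι : Type*} (Q : ι → ℂ) (i : ι)

theorem normalInd_nonneg (t : ℝ) : 0 ≤ normalInd Q i t := by
  unfold normalInd; split_ifs <;> norm_num

theorem norm_normalInd_le (t : ℝ) : ‖normalInd Q i t‖ ≤ 1 := by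
  unfold normalInd; split_ifs <;> norm_num

theorem measurable_normalInd : Measurable (normalInd Q i) :=
  Measurable.ite ((isClosed_normalCone Q i).preimage continuous_dir).measurableSet
    measurable_const measurable_const

theorem intervalIntegrable_normalInd (a b : ℝ) :
    IntervalIntegrable (normalInd Q i) volume a b :=
  (intervalIntegrable_const (c := (1 : ℝ))).mono_fun
    (measurable_normalInd Q i).aestronglyMeasurable
    (Eventually.of_forall fun t => by simpa using norm_normalInd_le Q i t)

variable {Q i}

/-- The directions normal at `Q i` have measure equal to the exterior angle. -/
theorem integral_normalInd (hπ : extAngle Q i < π) :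
    ∫ t in (0)..(2 * π), normalInd Q i t = extAngle Q i := by
  by_cases hne : (unitNormals Q i).Nonempty
  · obtain ⟨t₀, ht₀⟩ := exists_arc hne hπ
    have hper : Function.Periodic (normalInd Q i) (2 * π) := fun t => by
      unfold normalInd; rw [dir_periodic t]
    have h0 := extAngle_nonneg Q i
    -- Centre the period at `t₀`, so that the arc of normals is a single interval inside it.
    have e := hper.intervalIntegral_add_eq 0 (t₀ + -π)
    rw [zero_add, show t₀ + -π + 2 * π = t₀ + π by ring,
      ← intervalIntegral.integral_comp_add_left] at e
    rw [e]
    have hcongr : ∀ φ ∈ uIcc (-π) π, normalInd Q i (t₀ + φ) =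
        (Icc (-(extAngle Q i / 2)) (extAngle Q i / 2)).indicator (fun _ => (1 : ℝ)) φ := by
      intro φ hφ
      rw [uIcc_of_le (by linarith [Real.pi_pos])] at hφ
      simp only [normalInd, ht₀ φ hφ, indicator, mem_Icc, abs_le]
    rw [intervalIntegral.integral_congr hcongr,
      intervalIntegral.integral_of_le (by linarith [Real.pi_pos]),
      setIntegral_indicator measurableSet_Icc, setIntegral_const]
    have hsub : Icc (-(extAngle Q i / 2)) (extAngle Q i / 2) ⊆ Ioc (-π) π := fun x hx =>
      ⟨by linarith [hx.1], by linarith [hx.2]⟩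
    rw [inter_eq_right.2 hsub, Real.volume_real_Icc_of_le (by linarith)]
    simp
  · rw [extAngle_of_empty hne]
    have : normalInd Q i = fun _ => 0 := funext fun t =>
      if_neg fun h => hne ⟨dir t, norm_dir t, h⟩
    simp [this]

end NormalInd

theorem inner_dir (t : ℝ) (d : ℂ) : inner ℝ (dir t) d = ‖d‖ * Real.cos (t - d.arg) := by
  rw [dir_eq, Real.cos_sub, mul_add, mul_left_comm, Complex.norm_mul_cos_arg, mul_left_comm,
    Complex.norm_mul_sin_arg, Complex.inner]
  simp [-Complex.ofReal_cos, -Complex.ofReal_sin, mul_comm]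

theorem ae_inner_dir_ne {d : ℂ} (hd : d ≠ 0) : ∀ᵐ t : ℝ, inner ℝ (dir t) d ≠ 0 := by
  have hc : ({t : ℝ | inner ℝ (dir t) d = 0}).Countable := by
    refine (countable_range fun k : ℤ => (2 * k + 1) * π / 2 + d.arg).mono fun t ht => ?_
    rw [mem_ofPred_eq, inner_dir, mul_eq_zero, Real.cos_eq_zero_iff] at ht
    rcases ht with ht | ⟨k, hk⟩
    · exact absurd (norm_eq_zero.1 ht) hd
    · exact ⟨k, by linarith⟩
  simpa [ae_iff] using hc.measure_zero volume

/-- Only directions orthogonal to some difference `Q i - Q j` are excluded, a countable set. In all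
others the farthest point is unique. -/
theorem ae_inner_dir_injective {ι : Type*} [Countable ι] {Q : ι → ℂ}
    (hQ : Function.Injective Q) :
    ∀ᵐ t : ℝ, ∀ i j, i ≠ j → inner ℝ (dir t) (Q i) ≠ inner ℝ (dir t) (Q j) := by
  rw [ae_all_iff]; intro i
  rw [ae_all_iff]; intro j
  by_cases h : i = j
  · simp [h]
  · filter_upwards [ae_inner_dir_ne (sub_ne_zero.2 (hQ.ne h))] with t ht _ he
    exact ht (by rw [inner_sub_right, he, sub_self])

theorem sum_normalInd_ae {ι : Type*} [Fintype ι] [Nonempty ι] {Q : ι → ℂ}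
    (hQ : Function.Injective Q) : ∀ᵐ t : ℝ, ∑ i, normalInd Q i t = 1 := by
  filter_upwards [ae_inner_dir_injective hQ] with t ht
  obtain ⟨i, hi⟩ := Finite.exists_max fun j => inner ℝ (dir t) (Q j)
  rw [Finset.sum_eq_single i]
  · exact if_pos hi
  · exact fun j _ hj => if_neg fun h => ht i j hj.symm (le_antisymm (h i) (hi j))
  · simp

/-- The exterior angles of a planar configuration add up to `2π`. -/
theorem sum_extAngle {ι : Type*} [Fintype ι] [Nonempty ι] {Q : ι → ℂ}
    (hQ : Function.Injective Q) (hπ : ∀ i, extAngle Q i < π) : ∑ i, extAngle Q i = 2 * π := by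
  rw [← Finset.sum_congr rfl fun i _ => integral_normalInd (hπ i),
    ← intervalIntegral.integral_finsetSum fun i _ => intervalIntegrable_normalInd Q i _ _,
    intervalIntegral.integral_congr_ae (g := fun _ => (1 : ℝ))]
  · simp
  · filter_upwards [sum_normalInd_ae hQ] with t ht _ using ht

/-- The exterior angles depend continuously on the configuration. -/
theorem tendsto_extAngle {X ι : Type*} [Finite ι] {l : Filter X} [l.IsCountablyGenerated]
    {Q : X → ι → ℂ} {Q₀ : ι → ℂ} (hQ : ∀ j, Tendsto (fun x => Q x j) l (𝓝 (Q₀ j)))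
    (hinj : Function.Injective Q₀) {i : ι} (hπ : ∀ᶠ x in l, extAngle (Q x) i < π)
    (hπ₀ : extAngle Q₀ i < π) : Tendsto (fun x => extAngle (Q x) i) l (𝓝 (extAngle Q₀ i)) := by
  have key : Tendsto (fun x => ∫ t in (0)..(2 * π), normalInd (Q x) i t) l
      (𝓝 (∫ t in (0)..(2 * π), normalInd Q₀ i t)) := by
    refine intervalIntegral.tendsto_integral_filter_of_dominated_convergence (fun _ => (1 : ℝ))
      (Eventually.of_forall fun x => (measurable_normalInd _ _).aestronglyMeasurable)
      (Eventually.of_forall fun x => Eventually.of_forall fun t _ => norm_normalInd_le _ _ t)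
      intervalIntegrable_const ?_
    -- For such `t`, both membership in the limit cone and its failure are witnessed by strict
    -- inequalities, which persist nearby; the indicators are eventually constant.
    filter_upwards [ae_inner_dir_injective hinj] with t ht _
    have hin : ∀ j, Tendsto (fun x => inner ℝ (dir t) (Q x j)) l (𝓝 (inner ℝ (dir t) (Q₀ j))) :=
      fun j => tendsto_const_nhds.inner (hQ j)
    refine tendsto_const_nhds.congr' ?_
    by_cases h : dir t ∈ normalCone Q₀ i
    · have hev : ∀ᶠ x in l, ∀ j, inner ℝ (dir t) (Q x j) ≤ inner ℝ (dir t) (Q x i) := by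
        rw [eventually_all]
        intro j
        by_cases hj : j = i
        · exact Eventually.of_forall fun x => by rw [hj]
        · exact ((hin j).eventually_lt (hin i) (lt_of_le_of_ne (h j) (ht j i hj))).mono
            fun _ => le_of_lt
      filter_upwards [hev] with x hx
      exact (if_pos h).trans (if_pos hx).symm
    · have : ∃ j, inner ℝ (dir t) (Q₀ i) < inner ℝ (dir t) (Q₀ j) := by
        simpa [normalCone] using h
      obtain ⟨j, hj⟩ := this
      filter_upwards [(hin i).eventually_lt (hin j) hj] with x hx
      exact (if_neg h).trans (if_neg fun h' => (h' j).not_gt hx).symm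
  rw [integral_normalInd hπ₀] at key
  exact key.congr' (hπ.mono fun x hx => integral_normalInd hx)

/-! ### Weights at points of the convex hull -/

section Hull

variable {n : ℕ} {p : Fin n → ℂ} {s : ℂ}

theorem collinear_of_inner_eq {S : Set ℂ} {u s : ℂ} (hu : u ≠ 0)
    (h : ∀ x ∈ S, inner ℝ u (x - s) = 0) : Collinear ℝ S := by
  rw [collinear_iff_exists_forall_eq_smul_vadd]
  refine ⟨s, I * u, fun x hx => ⟨inner ℝ (I * u) (x - s) / ‖u‖ ^ 2, ?_⟩⟩
  have h0 := h x hx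
  have hn : (‖u‖ ^ 2 : ℝ) ≠ 0 := pow_ne_zero 2 (norm_ne_zero_iff.2 hu)
  rw [vadd_eq_add, ← sub_eq_iff_eq_add, div_eq_inv_mul, mul_smul, eq_inv_smul_iff₀ hn]
  rw [← Complex.normSq_eq_norm_sq, Complex.normSq_apply]
  rw [Complex.inner] at h0 ⊢
  generalize x - s = w at h0 ⊢
  simp at h0
  apply Complex.ext
  · simp
    linear_combination u.re * h0
  · simp
    linear_combination u.im * h0

theorem notMem_convexHull_of_inner_pos {S : Set ℂ} {u s : ℂ}
    (h : ∀ x ∈ S, 0 < inner ℝ u (x - s)) : s ∉ convexHull ℝ S := fun hs => by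
  have hc : Convex ℝ {x | inner ℝ u s < inner ℝ u x} :=
    convex_halfSpace_gt (innerSL ℝ u).toLinearMap.isLinear _
  have := convexHull_min (fun x hx => by
    have := h x hx
    rw [inner_sub_right, sub_pos] at this
    exact this) hc hs
  exact lt_irrefl (inner ℝ u s) this

theorem norm_sub_sq_pos (hs : s ∉ range p) (j : Fin n) : 0 < ‖p j - s‖ ^ 2 :=
  pow_pos (norm_pos_iff.2 (sub_ne_zero.2 fun h => hs ⟨j, h⟩)) 2

/-- Otherwise all samples lie on one circle or line through `s` with normal `u`. On a circle they
lie strictly on one side of its tangent at `s`, so `s` is outside the hull; a line contradicts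
noncollinearity. -/
theorem invert_spread (hcol : ¬ Collinear ℝ (range p)) (hs : s ∈ convexHull ℝ (range p))
    (hsp : s ∉ range p) (u : ℂ) (hu : u ≠ 0) :
    ∃ j k, inner ℝ u (invert s (p j)) ≠ inner ℝ u (invert s (p k)) := by
  by_contra! h
  obtain ⟨_, k, rfl⟩ := convexHull_nonempty_iff.1 ⟨s, hs⟩
  set a := inner ℝ u (invert s (p k)) with ha
  have key : ∀ j, inner ℝ u (p j - s) = ‖p j - s‖ ^ 2 * a := fun j => by
    rw [ha, ← h j k, inner_invert, mul_inv_cancel_left₀ (norm_sub_sq_pos hsp j).ne']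
  rcases lt_trichotomy a 0 with ha | ha | ha
  · refine notMem_convexHull_of_inner_pos (u := -u) ?_ hs
    rintro _ ⟨j, rfl⟩
    rw [inner_neg_left, key]
    nlinarith [norm_sub_sq_pos hsp j]
  · refine hcol (collinear_of_inner_eq hu (s := s) ?_)
    rintro _ ⟨j, rfl⟩
    rw [key, ha, mul_zero]
  · refine notMem_convexHull_of_inner_pos (u := u) ?_ hs
    rintro _ ⟨j, rfl⟩
    rw [key]
    exact mul_pos (norm_sub_sq_pos hsp j) ha

theorem luneAngle_nonneg (p : Fin n → ℂ) (s : ℂ) (i : Fin n) : 0 ≤ luneAngle p s i :=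
  Real.sSup_nonneg (by rintro _ ⟨u, -, v, -, rfl⟩; exact angle_nonneg u v)

theorem luneAngle_lt_pi (hcol : ¬ Collinear ℝ (range p)) (hs : s ∈ convexHull ℝ (range p))
    (hsp : s ∉ range p) (i : Fin n) : luneAngle p s i < π := by
  rw [luneAngle_eq hsp]
  exact extAngle_lt_pi (invert_spread hcol hs hsp)

theorem luneAngle_of_notMem {i : Fin n} (h : i ∉ extNeighbors p s) : luneAngle p s i = 0 := by
  have : emptyNormals p s i = ∅ := by
    simpa [extNeighbors, IsExtNeighbor, not_nonempty_iff_eq_empty] using h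
  simp [luneAngle, this]

theorem totalWeight_eq (p : Fin n → ℂ) (s : ℂ) :
    totalWeight p s = ∑ i, Real.tan (luneAngle p s i / 2) :=
  Finset.sum_subset (Finset.subset_univ _) fun i _ h => by simp [luneAngle_of_notMem h]

theorem neighborAverage_eq {𝕜 : Type*} [RCLike 𝕜] (p : Fin n → ℂ) (z : Fin n → 𝕜) (s : ℂ) :
    neighborAverage p z s = ∑ i, weight p s i • z i :=
  Finset.sum_subset (Finset.subset_univ _) fun i _ h => by
    simp [weight, luneAngle_of_notMem h]

theorem tan_half_luneAngle_nonneg {i : Fin n} (h : luneAngle p s i < π) :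
    0 ≤ Real.tan (luneAngle p s i / 2) :=
  Real.tan_nonneg_of_nonneg_of_le_pi_div_two (by linarith [luneAngle_nonneg p s i]) (by linarith)

theorem invert_injective (hp : Function.Injective p) (hsp : s ∉ range p) :
    Function.Injective fun j => invert s (p j) := fun i j h =>
  hp (invert_injective_of_ne (fun h => hsp ⟨i, h⟩) (fun h => hsp ⟨j, h⟩) h)

theorem sum_luneAngle [Nonempty (Fin n)] (hp : Function.Injective p) (hsp : s ∉ range p)
    (hπ : ∀ i, luneAngle p s i < π) : ∑ i, luneAngle p s i = 2 * π := by
  simp only [luneAngle_eq hsp] at hπ ⊢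
  exact sum_extAngle (invert_injective hp hsp) hπ

/-- The half-angles add up to `π`, and `x ≤ tan x`. -/
theorem pi_le_totalWeight [Nonempty (Fin n)] (hp : Function.Injective p) (hsp : s ∉ range p)
    (hπ : ∀ i, luneAngle p s i < π) : π ≤ totalWeight p s := by
  rw [totalWeight_eq, show π = ∑ i, luneAngle p s i / 2 by
    rw [← Finset.sum_div, sum_luneAngle hp hsp hπ]; ring]
  exact Finset.sum_le_sum fun i _ =>
    Real.le_tan (by linarith [luneAngle_nonneg p s i]) (by linarith [hπ i])

theorem nonempty_of_mem_convexHull (hs : s ∈ convexHull ℝ (range p)) : Nonempty (Fin n) := by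
  obtain ⟨_, k, rfl⟩ := convexHull_nonempty_iff.1 ⟨s, hs⟩
  exact ⟨k⟩

theorem interpolant_of_notMem {𝕜 : Type*} [RCLike 𝕜] (z : Fin n → 𝕜) (hsp : s ∉ range p) :
    interpolant p z s = neighborAverage p z s :=
  dif_neg hsp

theorem interpolant_apply {𝕜 : Type*} [RCLike 𝕜] (hp : Function.Injective p) (z : Fin n → 𝕜)
    (i : Fin n) : interpolant p z (p i) = z i := by
  have h : ∃ j, p j = p i := ⟨i, rfl⟩
  rw [interpolant, dif_pos h, hp h.choose_spec]

theorem continuousAt_invert {s x : ℂ} (h : x ≠ s) : ContinuousAt (fun s => invert s x) s := by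
  have h1 : ContinuousAt (fun s => ‖x - s‖ ^ 2) s := by fun_prop
  have h2 : ContinuousAt (fun s => x - s) s := by fun_prop
  exact (h1.inv₀ (pow_ne_zero 2 (norm_ne_zero_iff.2 (sub_ne_zero.2 h)))).smul h2

theorem tendsto_luneAngle (hp : Function.Injective p) (hcol : ¬ Collinear ℝ (range p))
    (hs : s ∈ convexHull ℝ (range p)) (hsp : s ∉ range p) (i : Fin n) :
    Tendsto (fun x => luneAngle p x i) (𝓝[convexHull ℝ (range p)] s) (𝓝 (luneAngle p s i)) := by
  have hev : ∀ᶠ x in 𝓝[convexHull ℝ (range p)] s, x ∈ convexHull ℝ (range p) ∧ x ∉ range p :=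
    (eventually_mem_nhdsWithin).and (eventually_nhdsWithin_of_eventually_nhds
      ((finite_range p).isClosed.isOpen_compl.mem_nhds hsp))
  have key : Tendsto (fun x => extAngle (fun j => invert x (p j)) i)
      (𝓝[convexHull ℝ (range p)] s) (𝓝 (extAngle (fun j => invert s (p j)) i)) :=
    tendsto_extAngle
      (fun j => (continuousAt_invert fun h => hsp ⟨j, h⟩).tendsto.mono_left nhdsWithin_le_nhds)
      (invert_injective hp hsp)
      (hev.mono fun x hx => extAngle_lt_pi (invert_spread hcol hx.1 hx.2))
      (extAngle_lt_pi (invert_spread hcol hs hsp))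
  rw [← luneAngle_eq hsp] at key
  exact key.congr' (hev.mono fun x hx => (luneAngle_eq hx.2 i).symm)

theorem tendsto_neighborAverage {𝕜 : Type*} [RCLike 𝕜] (z : Fin n → 𝕜)
    (hp : Function.Injective p) (hcol : ¬ Collinear ℝ (range p))
    (hs : s ∈ convexHull ℝ (range p)) (hsp : s ∉ range p) :
    Tendsto (neighborAverage p z) (𝓝[convexHull ℝ (range p)] s) (𝓝 (neighborAverage p z s)) := by
  have : Nonempty (Fin n) := nonempty_of_mem_convexHull hs
  have hlt := luneAngle_lt_pi hcol hs hsp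
  have hT : ∀ i, Tendsto (fun x => Real.tan (luneAngle p x i / 2))
      (𝓝[convexHull ℝ (range p)] s) (𝓝 (Real.tan (luneAngle p s i / 2))) := fun i => by
    have hcos : Real.cos (luneAngle p s i / 2) ≠ 0 := (Real.cos_pos_of_mem_Ioo
      ⟨by linarith [luneAngle_nonneg p s i, Real.pi_pos], by linarith [hlt i]⟩).ne'
    exact (Real.continuousAt_tan.2 hcos).tendsto.comp
      ((tendsto_luneAngle hp hcol hs hsp i).div_const 2)
  have hW : Tendsto (totalWeight p) (𝓝[convexHull ℝ (range p)] s) (𝓝 (totalWeight p s)) := by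
    simp only [funext (totalWeight_eq p), totalWeight_eq p s]
    exact tendsto_finsetSum _ fun i _ => hT i
  have hW0 : totalWeight p s ≠ 0 :=
    (Real.pi_pos.trans_le (pi_le_totalWeight hp hsp hlt)).ne'
  simp only [funext (neighborAverage_eq p z), neighborAverage_eq p z s, weight]
  exact tendsto_finsetSum _ fun i _ => ((hT i).div hW hW0).smul_const (z i)

end Hull

/-! ### Behavior near a sample point -/

/-- When `Q i` dominates the other points in norm, the two directions at angle `π / 2 - η` from `Q
i` are normal there, by Cauchy–Schwarz. -/
theorem le_extAngle_of_norm_le {ι : Type*} {Q : ι → ℂ} {i : ι} {η : ℝ} (h0 : 0 ≤ η)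
    (hη : η ≤ π / 2) (h : ∀ j, j ≠ i → ‖Q j‖ ≤ ‖Q i‖ * Real.sin η) :
    π - 2 * η ≤ extAngle Q i := by
  have key : ∀ t, Real.cos (t - (Q i).arg) = Real.sin η → dir t ∈ unitNormals Q i := by
    refine fun t ht => ⟨norm_dir t, fun j => ?_⟩
    by_cases hj : j = i
    · rw [hj]
    · calc inner ℝ (dir t) (Q j) ≤ ‖dir t‖ * ‖Q j‖ := real_inner_le_norm _ _
        _ ≤ ‖Q i‖ * Real.sin η := by rw [norm_dir, one_mul]; exact h j hj
        _ = inner ℝ (dir t) (Q i) := by rw [inner_dir, ht]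
  have h1 := key ((Q i).arg + (π / 2 - η)) (by rw [add_sub_cancel_left, Real.cos_pi_div_two_sub])
  have h2 := key ((Q i).arg - (π / 2 - η)) (by
    rw [sub_sub_cancel_left, Real.cos_neg, Real.cos_pi_div_two_sub])
  have h3 : |(Q i).arg + (π / 2 - η) - ((Q i).arg - (π / 2 - η))| = π - 2 * η := by
    rw [abs_of_nonneg] <;> linarith
  have h4 := angle_le_extAngle h1 h2
  rwa [angle_dir (by rw [h3]; linarith), h3] at h4

section Sample

variable {n : ℕ} {p : Fin n → ℂ}

theorem norm_invert (s x : ℂ) : ‖invert s x‖ = ‖x - s‖⁻¹ := by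
  rw [invert_eq, norm_inv, Complex.norm_conj]

theorem tendsto_norm_invert_atTop (x : ℂ) :
    Tendsto (fun s => ‖invert s x‖) (𝓝[≠] x) atTop := by
  simp only [norm_invert]
  refine tendsto_inv_nhdsGT_zero.comp (tendsto_nhdsWithin_iff.2 ⟨?_, ?_⟩)
  · have : ContinuousAt (fun s => ‖x - s‖) x := by fun_prop
    have h := this.tendsto
    rw [sub_self, norm_zero] at h
    exact h.mono_left nhdsWithin_le_nhds
  · filter_upwards [self_mem_nhdsWithin] with s hs
    exact norm_pos_iff.2 (sub_ne_zero.2 (Ne.symm hs))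

theorem tendsto_luneAngle_self (hp : Function.Injective p) (hcol : ¬ Collinear ℝ (range p))
    (i : Fin n) :
    Tendsto (fun s => luneAngle p s i) (𝓝[convexHull ℝ (range p) \ range p] (p i)) (𝓝[<] π) := by
  have hmem : ∀ᶠ s in 𝓝[convexHull ℝ (range p) \ range p] (p i),
      s ∈ convexHull ℝ (range p) ∧ s ∉ range p := eventually_mem_nhdsWithin
  have hle : 𝓝[convexHull ℝ (range p) \ range p] (p i) ≤ 𝓝[≠] (p i) :=
    nhdsWithin_mono _ fun s hs h => hs.2 ⟨i, h.symm⟩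
  refine tendsto_nhdsWithin_iff.2 ⟨tendsto_order.2 ⟨fun b hb => ?_, fun b hb => ?_⟩,
    hmem.mono fun s hs => luneAngle_lt_pi hcol hs.1 hs.2 i⟩
  · rcases lt_or_ge b 0 with hb0 | hb0
    · exact Eventually.of_forall fun s => hb0.trans_le (luneAngle_nonneg p s i)
    -- This gives `π - 2 * η = (π + b) / 2 > b`; `b ≥ 0` ensures `η ≤ π / 2`.
    set η := (π - b) / 4 with hη
    have hsin : 0 < Real.sin η :=
      Real.sin_pos_of_pos_of_lt_pi (by linarith) (by linarith [Real.pi_pos])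
    have hev : ∀ᶠ s in 𝓝[convexHull ℝ (range p) \ range p] (p i), ∀ j, j ≠ i →
        ‖invert s (p j)‖ ≤ ‖invert s (p i)‖ * Real.sin η := by
      rw [eventually_all]
      intro j
      by_cases hj : j = i
      · simp [hj]
      · have h1 : Tendsto (fun s => ‖invert s (p j)‖)
            (𝓝[convexHull ℝ (range p) \ range p] (p i)) (𝓝 ‖invert (p i) (p j)‖) :=
          ((continuousAt_invert (hp.ne hj)).norm.tendsto).mono_left nhdsWithin_le_nhds
        have h2 := (((tendsto_norm_invert_atTop (p i)).mono_left hle).atTop_mul_const hsin)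
        filter_upwards [h1.eventually_lt_const (lt_add_one _),
          h2.eventually_ge_atTop (‖invert (p i) (p j)‖ + 1)] with s h3 h4 _
        exact h3.le.trans h4
    filter_upwards [hev, hmem] with s hs hs'
    rw [luneAngle_eq hs'.2]
    refine lt_of_lt_of_le ?_ (le_extAngle_of_norm_le (by linarith) (by linarith) hs)
    linarith
  · exact hmem.mono fun s hs => (luneAngle_lt_pi hcol hs.1 hs.2 i).trans hb

/-- The cone with apex `q` cut out by this inequality is convex. -/
theorem convexHull_inner_ge {S : Set ℂ} {x q : ℂ} {c : ℝ} (hc : 0 ≤ c)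
    (h : ∀ y ∈ S, c * ‖y - q‖ ≤ inner ℝ x (y - q)) {s : ℂ} (hs : s ∈ convexHull ℝ S) :
    c * ‖s - q‖ ≤ inner ℝ x (s - q) := by
  refine convexHull_min (t := {y | c * ‖y - q‖ ≤ inner ℝ x (y - q)}) h ?_ hs
  intro y hy w hw a b ha hb hab
  rw [mem_ofPred_eq] at *
  have e : a • y + b • w - q = a • (y - q) + b • (w - q) := by
    obtain rfl : b = 1 - a := by linarith
    simp only [Complex.real_smul]
    push_cast
    ring
  have hn : ‖a • y + b • w - q‖ ≤ a * ‖y - q‖ + b * ‖w - q‖ := by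
    rw [e]
    refine (norm_add_le _ _).trans_eq ?_
    rw [norm_smul, norm_smul, Real.norm_of_nonneg ha, Real.norm_of_nonneg hb]
  calc c * ‖a • y + b • w - q‖ ≤ c * (a * ‖y - q‖ + b * ‖w - q‖) :=
        mul_le_mul_of_nonneg_left hn hc
    _ = a * (c * ‖y - q‖) + b * (c * ‖w - q‖) := by ring
    _ ≤ a * inner ℝ x (y - q) + b * inner ℝ x (w - q) :=
        add_le_add (mul_le_mul_of_nonneg_left hy ha) (mul_le_mul_of_nonneg_left hw hb)
    _ = inner ℝ x (a • y + b • w - q) := by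
        rw [e, inner_add_right, real_inner_smul_right, real_inner_smul_right]

/-- A direction of approach to `p i` within the hull is not tangent to a circle that passes through
all the samples. -/
theorem not_tendsto_inner_of_circle (hp : Function.Injective p) {i : Fin n} {x : ℂ} {a : ℝ}
    (ha : 0 < a) (h : ∀ j, j ≠ i → inner ℝ x (invert (p i) (p j)) = a) {l : Filter ℂ} [l.NeBot]
    (hl : l ≤ 𝓝[convexHull ℝ (range p) \ range p] (p i)) :
    ¬ Tendsto (fun s => inner ℝ x (‖p i - s‖⁻¹ • (p i - s))) l (𝓝 0) := fun ht => by
  -- The circle gives `⟪x, p j - p i⟫ = a * ‖p j - p i‖ ^ 2`. Since the other samples stay at a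
  -- positive distance from `p i`, they lie in a cone with apex `p i` that meets the tangent only
  -- there, and so does the hull.
  have hc : ∃ c : ℝ, 0 < c ∧ ∀ j, j ≠ i → c ≤ a * ‖p j - p i‖ := by
    have := eventually_all.2 fun j : Fin n => (show ∀ᶠ c : ℝ in 𝓝[>] 0, j ≠ i →
      c ≤ a * ‖p j - p i‖ by
        by_cases hj : j = i
        · simp [hj]
        · have : 0 < a * ‖p j - p i‖ := mul_pos ha (norm_pos_iff.2 (sub_ne_zero.2 (hp.ne hj)))
          filter_upwards [Ioo_mem_nhdsGT this] with c hc _ using hc.2.le)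
    obtain ⟨c, h1, h2⟩ := (this.and self_mem_nhdsWithin).exists
    exact ⟨c, h2, h1⟩
  obtain ⟨c, hc0, hc⟩ := hc
  have hS : ∀ y ∈ range p, c * ‖y - p i‖ ≤ inner ℝ x (y - p i) := by
    rintro _ ⟨j, rfl⟩
    by_cases hj : j = i
    · simp [hj]
    · have hpos : 0 < ‖p j - p i‖ := norm_pos_iff.2 (sub_ne_zero.2 (hp.ne hj))
      have h1 := h j hj
      rw [inner_invert, inv_mul_eq_iff_eq_mul₀ (pow_pos hpos 2).ne'] at h1
      rw [h1]
      nlinarith [hc j hj]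
  have hev : ∀ᶠ s in l, inner ℝ x (‖p i - s‖⁻¹ • (p i - s)) ≤ -c := by
    filter_upwards [hl self_mem_nhdsWithin] with s hs
    have hne : p i - s ≠ 0 := sub_ne_zero.2 fun h => hs.2 ⟨i, h⟩
    have h1 := convexHull_inner_ge hc0.le hS hs.1
    rw [real_inner_smul_right, inv_mul_le_iff₀ (norm_pos_iff.2 hne), ← neg_sub s, inner_neg_right,
      norm_neg]
    linarith
  linarith [le_of_tendsto ht hev]

/-- If `θ_j` came arbitrarily close to `π`, a limit along an ultrafilter would give opposite normals
`x` and `r • x` with `r < 0`. Then all samples lie on one circle or line through `p i` with normal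
`x`, and `s` approaches `p i` tangentially to it. Noncollinearity excludes the line, and
`not_tendsto_inner_of_circle` the circle. -/
theorem exists_luneAngle_bound (hp : Function.Injective p) (hcol : ¬ Collinear ℝ (range p))
    {i j : Fin n} (hj : j ≠ i) :
    ∃ b < π, ∀ᶠ s in 𝓝[convexHull ℝ (range p) \ range p] (p i), luneAngle p s j ≤ b := by
  by_contra! hcon
  set l := 𝓝[convexHull ℝ (range p) \ range p] (p i) with hl
  have hmem : ∀ᶠ s in l, s ∈ convexHull ℝ (range p) ∧ s ∉ range p := eventually_mem_nhdsWithin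
  have hcl : MapClusterPt π l fun s => luneAngle p s j := by
    rw [mapClusterPt_iff_frequently]
    intro V hV
    obtain ⟨b, hb, hbV⟩ := exists_Ioc_subset_of_mem_nhds hV ⟨π - 1, by linarith⟩
    refine ((hcon b hb).and_eventually hmem).mono fun s hs => hbV ⟨hs.1, ?_⟩
    exact (luneAngle_lt_pi hcol hs.2.1 hs.2.2 j).le
  obtain ⟨U, hUl, hU⟩ := mapClusterPt_iff_ultrafilter.1 hcl
  have hex : ∀ᶠ s in (U : Filter ℂ), ∃ uv : ℂ × ℂ,
      uv.1 ∈ unitNormals (fun m => invert s (p m)) j ∧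
      uv.2 ∈ unitNormals (fun m => invert s (p m)) j ∧ angle uv.1 uv.2 = luneAngle p s j := by
    filter_upwards [hU.eventually_const_lt Real.pi_pos, hUl hmem] with s hs hs'
    rw [luneAngle_eq hs'.2] at hs ⊢
    by_cases hne : (unitNormals (fun m => invert s (p m)) j).Nonempty
    · obtain ⟨u, hu, v, hv, huv⟩ := exists_angle_eq_extAngle hne
      exact ⟨(u, v), hu, hv, huv⟩
    · rw [extAngle_of_empty hne] at hs
      exact absurd hs (lt_irrefl _)
  obtain ⟨uv, huv⟩ := hex.choice
  have hlim : ∀ w : ℂ → ℂ, (∀ᶠ s in (U : Filter ℂ), ‖w s‖ = 1) →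
      ∃ x, ‖x‖ = 1 ∧ Tendsto w U (𝓝 x) := fun w hw => by
    obtain ⟨x, hx, hx'⟩ := (isCompact_sphere (0 : ℂ) 1).ultrafilter_le_nhds (U.map w)
      (le_principal_iff.2 (hw.mono fun s hs => by simpa using hs))
    exact ⟨x, by simpa using hx, hx'⟩
  obtain ⟨x, hx1, hx⟩ := hlim (fun s => (uv s).1) (huv.mono fun s h => h.1.1)
  obtain ⟨y, hy1, hy⟩ := hlim (fun s => (uv s).2) (huv.mono fun s h => h.2.1.1)
  obtain ⟨e, -, he⟩ := hlim (fun s => ‖p i - s‖⁻¹ • (p i - s)) ((hmem.filter_mono hUl).mono fun s h => by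
    have : ‖p i - s‖ ≠ 0 := norm_ne_zero_iff.2 (sub_ne_zero.2 fun h' => h.2 ⟨i, h'⟩)
    rw [norm_smul, norm_inv, norm_norm, inv_mul_cancel₀ this])
  have hxy : angle x y = π := by
    have h1 : Tendsto (fun s => angle (uv s).1 (uv s).2) U (𝓝 (angle x y)) :=
      (continuousAt_angle (x := (x, y)) (ne_zero_of_norm_eq_one hx1)
        (ne_zero_of_norm_eq_one hy1)).tendsto.comp (hx.prodMk_nhds hy)
    exact tendsto_nhds_unique (h1.congr' (huv.mono fun s h => h.2.2)) hU
  obtain ⟨hx0, r, hr, rfl⟩ := angle_eq_pi_iff.1 hxy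
  have hUp : Tendsto (fun s : ℂ => s) U (𝓝 (p i)) :=
    (hUl.trans nhdsWithin_le_nhds)
  have hq : ∀ m, m ≠ i → Tendsto (fun s => invert s (p m)) U (𝓝 (invert (p i) (p m))) :=
    fun m hm => (continuousAt_invert (hp.ne hm)).tendsto.comp hUp
  have hconst : ∀ m, m ≠ i →
      inner ℝ x (invert (p i) (p m)) = inner ℝ x (invert (p i) (p j)) := fun m hm => by
    have h1 := le_of_tendsto_of_tendsto (hx.inner (hq m hm)) (hx.inner (hq j hj))
      (huv.mono fun s h => h.1.2 m)
    have h2 := le_of_tendsto_of_tendsto (hy.inner (hq m hm)) (hy.inner (hq j hj))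
      (huv.mono fun s h => h.2.1.2 m)
    rw [real_inner_smul_left, real_inner_smul_left] at h2
    nlinarith
  have hnorm : Tendsto (fun s => ‖p i - s‖) U (𝓝 0) := by
    have := (tendsto_const_nhds (x := p i)).sub hUp
    simpa using this.norm
  -- The inverted `p i` goes to infinity in direction `e`. Rescaling its normality inequality by `‖p
  -- i - s‖ → 0` leaves `⟪w₀, e⟫ ≤ 0`; applied to both opposite normals, this makes `e` orthogonal
  -- to `x`.
  have htan : ∀ (w : ℂ → ℂ) (w₀ : ℂ), Tendsto w U (𝓝 w₀) →
      (∀ᶠ s in (U : Filter ℂ), w s ∈ unitNormals (fun m => invert s (p m)) j) →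
      inner ℝ w₀ e ≤ 0 := fun w w₀ hw hwn => by
    have h1 := hnorm.mul (hw.inner (hq j hj))
    rw [zero_mul] at h1
    refine le_of_tendsto_of_tendsto (hw.inner he) h1 ?_
    filter_upwards [hwn, hUl hmem] with s hs hs'
    have hpos : 0 < ‖p i - s‖ := norm_pos_iff.2 (sub_ne_zero.2 fun h' => hs'.2 ⟨i, h'⟩)
    have h2 := mul_le_mul_of_nonneg_left (hs.2 i) hpos.le
    refine le_trans (le_of_eq ?_) h2
    simp only [inner_invert, real_inner_smul_right]
    field_simp
  have hxe : inner ℝ x e = 0 := by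
    have h1 := htan _ _ hx (huv.mono fun s h => h.1)
    have h2 := htan _ _ hy (huv.mono fun s h => h.2.1)
    rw [real_inner_smul_left] at h2
    nlinarith
  have hlim0 : ∀ w : ℂ, inner ℝ w e = 0 →
      Tendsto (fun s => inner ℝ w (‖p i - s‖⁻¹ • (p i - s))) U (𝓝 0) := fun w hw => by
    rw [← hw]; exact tendsto_const_nhds.inner he
  rcases lt_trichotomy (inner ℝ x (invert (p i) (p j))) 0 with ha | ha | ha
  · refine not_tendsto_inner_of_circle hp (x := -x) (neg_pos.2 ha) (fun m hm => ?_) hUl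
      (hlim0 _ ?_)
    · rw [inner_neg_left, hconst m hm]
    · rw [inner_neg_left, hxe, neg_zero]
  · refine hcol (collinear_of_inner_eq hx0 (s := p i) ?_)
    rintro _ ⟨m, rfl⟩
    by_cases hm : m = i
    · simp [hm]
    · have h1 := hconst m hm
      have hpos : 0 < ‖p m - p i‖ := norm_pos_iff.2 (sub_ne_zero.2 (hp.ne hm))
      rw [ha, inner_invert, inv_mul_eq_iff_eq_mul₀ (pow_pos hpos 2).ne', mul_zero] at h1
      exact h1
  · exact not_tendsto_inner_of_circle hp ha hconst hUl (hlim0 _ hxe)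

theorem tendsto_neighborAverage_sample {𝕜 : Type*} [RCLike 𝕜] (z : Fin n → 𝕜)
    (hp : Function.Injective p) (hcol : ¬ Collinear ℝ (range p)) (i : Fin n) :
    Tendsto (neighborAverage p z) (𝓝[convexHull ℝ (range p) \ range p] (p i)) (𝓝 (z i)) := by
  set l := 𝓝[convexHull ℝ (range p) \ range p] (p i) with hl
  have hmem : ∀ᶠ s in l, s ∈ convexHull ℝ (range p) ∧ s ∉ range p := eventually_mem_nhdsWithin
  have hTi : Tendsto (fun s => Real.tan (luneAngle p s i / 2)) l atTop := by
    refine Real.tendsto_tan_pi_div_two.comp ?_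
    obtain ⟨h1, h2⟩ := tendsto_nhdsWithin_iff.1 (tendsto_luneAngle_self hp hcol i)
    exact tendsto_nhdsWithin_iff.2 ⟨h1.div_const 2, h2.mono fun s hs => by
      rw [mem_Iio] at hs ⊢; linarith⟩
  have hT : ∀ j, ∀ᶠ s in l, 0 ≤ Real.tan (luneAngle p s j / 2) := fun j =>
    hmem.mono fun s hs => tan_half_luneAngle_nonneg (luneAngle_lt_pi hcol hs.1 hs.2 j)
  have hW : Tendsto (totalWeight p) l atTop := by
    refine tendsto_atTop_mono' l ?_ hTi
    filter_upwards [eventually_all.2 hT] with s hs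
    rw [totalWeight_eq]
    exact Finset.single_le_sum (f := fun j => Real.tan (luneAngle p s j / 2))
      (fun j _ => hs j) (Finset.mem_univ i)
  have hw : ∀ j, j ≠ i → Tendsto (fun s => weight p s j) l (𝓝 0) := fun j hj => by
    obtain ⟨b, hb, hbl⟩ := exists_luneAngle_bound hp hcol hj
    have h0 : Tendsto (fun s => Real.tan (b / 2) / totalWeight p s) l (𝓝 0) :=
      hW.const_div_atTop _
    refine tendsto_of_tendsto_of_tendsto_of_le_of_le' tendsto_const_nhds h0 ?_ ?_
    · filter_upwards [hT j, hW.eventually_gt_atTop 0] with s h1 h2 using div_nonneg h1 h2.le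
    · filter_upwards [hbl, hW.eventually_gt_atTop 0] with s h1 h2
      refine div_le_div_of_nonneg_right (Real.strictMonoOn_tan.monotoneOn ?_ ?_ ?_) h2.le
      · constructor <;> linarith [luneAngle_nonneg p s j, Real.pi_pos]
      · constructor <;> linarith [luneAngle_nonneg p s j, Real.pi_pos]
      · linarith
  -- Subtracting `z i` removes the `i`th term, so the limit of its weight is not needed.
  have hsum : Tendsto (fun s => z i + ∑ j, weight p s j • (z j - z i)) l (𝓝 (z i)) := by
    have : Tendsto (fun s => ∑ j, weight p s j • (z j - z i)) l (𝓝 (∑ _j : Fin n, (0 : 𝕜))) :=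
      tendsto_finsetSum _ fun j _ => by
        by_cases hj : j = i
        · simpa [hj] using tendsto_const_nhds
        · simpa using (hw j hj).smul_const (z j - z i)
    simpa using this.const_add (z i)
  refine hsum.congr' ?_
  filter_upwards [hW.eventually_gt_atTop 0] with s hs
  have h1 : ∑ j, weight p s j = 1 := by
    simp only [weight]
    rw [← Finset.sum_div, ← totalWeight_eq, div_self hs.ne']
  simp only [smul_sub, Finset.sum_sub_distrib, ← Finset.sum_smul, h1, one_smul,
    neighborAverage_eq]
  abel

theorem continuousOn_interpolant {𝕜 : Type*} [RCLike 𝕜] (z : Fin n → 𝕜)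
    (hp : Function.Injective p) (hcol : ¬ Collinear ℝ (range p)) :
    ContinuousOn (interpolant p z) (convexHull ℝ (range p)) := by
  intro s hs
  by_cases hsp : s ∈ range p
  · obtain ⟨i, rfl⟩ := hsp
    have h1 : ContinuousWithinAt (interpolant p z) (convexHull ℝ (range p) \ range p) (p i) := by
      rw [ContinuousWithinAt, interpolant_apply hp]
      refine (tendsto_neighborAverage_sample z hp hcol i).congr' ?_
      filter_upwards [self_mem_nhdsWithin] with s hs
      exact (interpolant_of_notMem z hs.2).symm
    refine (continuousWithinAt_singleton.union h1).mono_of_mem_nhdsWithin ?_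
    have hopen : (range p \ {p i})ᶜ ∈ 𝓝 (p i) :=
      ((finite_range p).subset sdiff_subset).isClosed.isOpen_compl.mem_nhds (by simp)
    filter_upwards [mem_nhdsWithin_of_mem_nhds hopen, self_mem_nhdsWithin] with s h2 h3
    by_cases h4 : s = p i
    · exact Or.inl h4
    · exact Or.inr ⟨h3, fun h5 => h2 ⟨h5, h4⟩⟩
  · rw [ContinuousWithinAt, interpolant_of_notMem z hsp]
    refine (tendsto_neighborAverage z hp hcol hs hsp).congr' ?_
    filter_upwards [mem_nhdsWithin_of_mem_nhds
      ((finite_range p).isClosed.isOpen_compl.mem_nhds hsp)] with x hx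
    exact (interpolant_of_notMem z hx).symm

end Sample

/-! ### Dense samples on a circle -/

section Gap

theorem ccwAngle_mem (c a b : ℂ) : ccwAngle c a b ∈ Ioc 0 (2 * π) := by
  simpa [ccwAngle] using toIocMod_mem_Ioc Real.two_pi_pos 0 (Complex.arg ((b - c) / (a - c)))

theorem dir_ccwAngle_mul {c a b : ℂ} {R : ℝ} (hR : 0 < R) (ha : ‖a - c‖ = R)
    (hb : ‖b - c‖ = R) : dir (ccwAngle c a b) * (a - c) = b - c := by
  have ha0 : a - c ≠ 0 := norm_ne_zero_iff.1 (by rw [ha]; exact hR.ne')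
  have hw : ‖(b - c) / (a - c)‖ = 1 := by rw [norm_div, ha, hb, div_self hR.ne']
  have h1 : dir (ccwAngle c a b) = dir (Complex.arg ((b - c) / (a - c))) := by
    rw [ccwAngle, toIocMod]
    exact dir_periodic.sub_zsmul_eq _
  have h2 := Complex.norm_mul_exp_arg_mul_I ((b - c) / (a - c))
  rw [hw, Complex.ofReal_one, one_mul] at h2
  rw [h1, dir, h2, div_mul_cancel₀ _ ha0]

theorem ccwAngle_eq {c a b : ℂ} {γ : ℝ} (hac : a ≠ c) (hγ : γ ∈ Ioc 0 (2 * π))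
    (h : dir γ * (a - c) = b - c) : ccwAngle c a b = γ := by
  rw [ccwAngle, ← h, mul_div_cancel_right₀ _ (sub_ne_zero.2 hac), dir, Complex.arg_exp_mul_I,
    toIocMod_toIocMod]
  exact (toIocMod_eq_self _).2 (by simpa using hγ)

theorem dir_add (x y : ℝ) : dir (x + y) = dir x * dir y := by
  rw [dir, dir, dir, ← Complex.exp_add]; push_cast; ring_nf

theorem norm_dir_sub_one_le (t : ℝ) : ‖dir t - 1‖ ≤ |t| := by
  rw [dir, mul_comm]; exact Real.norm_exp_I_mul_ofReal_sub_one_le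

/-- Every point of the circle is close to a sample if the gaps between the samples are small. -/
theorem exists_norm_sub_le_of_maxGap {n : ℕ} [Nonempty (Fin n)] {p : Fin n → ℂ} {c : ℂ} {R ε : ℝ}
    (hR : 0 < R) (hp : ∀ i, ‖p i - c‖ = R) (hgap : maxGap c p < ε) {x : ℂ} (hx : ‖x - c‖ = R) :
    ∃ j, ‖x - p j‖ ≤ R * ε := by
  -- `p i` is the last sample strictly before `x` counterclockwise; a sample at `x` itself counts as
  -- a full turn. Its successor `p j` cannot come strictly before `x`, since it would then be
  -- closer.
  obtain ⟨i, hi⟩ := Finite.exists_min fun i => ccwAngle c (p i) x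
  obtain ⟨j, hj⟩ := exists_eq_ciInf_of_finite (f := fun j => ccwAngle c (p i) (p j))
  have hα : ccwAngle c (p i) (p j) < ε := by
    rw [hj]
    exact (le_ciSup (f := fun i => ⨅ j, ccwAngle c (p i) (p j)) (finite_range _).bddAbove i).trans_lt
      hgap
  have h1 := dir_ccwAngle_mul hR (hp i) (hp j)
  have h2 := dir_ccwAngle_mul hR (hp i) hx
  have hα' := ccwAngle_mem c (p i) (p j)
  have hβ' := ccwAngle_mem c (p i) x
  rcases le_or_gt (ccwAngle c (p i) x) (ccwAngle c (p i) (p j)) with hle | hlt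
  · refine ⟨i, ?_⟩
    have e : x - p i = (dir (ccwAngle c (p i) x) - 1) * (p i - c) := by linear_combination -h2
    rw [e, norm_mul, hp i, mul_comm]
    refine mul_le_mul_of_nonneg_left ((norm_dir_sub_one_le _).trans ?_) hR.le
    rw [abs_of_pos hβ'.1]
    exact (hle.trans_lt hα).le
  · exfalso
    have hne : p j ≠ c := fun h => hR.ne (by rw [← hp j, h, sub_self, norm_zero])
    have h3 : ccwAngle c (p j) x = ccwAngle c (p i) x - ccwAngle c (p i) (p j) := by
      refine ccwAngle_eq hne ⟨by linarith, by linarith [hα'.1, hβ'.2]⟩ ?_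
      rw [← h1, ← mul_assoc, ← dir_add, sub_add_cancel, h2]
    linarith [hi j, hα'.1]

/-- If a half-plane contained `S` but not `s`, the point of the circle farthest out of it would be
more than `η` away from it, hence from `S`. -/
theorem mem_convexHull_of_dense {S : Set ℂ} (hS : S.Finite) {c s : ℂ} {R η : ℝ} (hR : 0 < R)
    (hs : ‖s - c‖ + η < R) (h : ∀ x, ‖x - c‖ = R → ∃ y ∈ S, ‖x - y‖ ≤ η) :
    s ∈ convexHull ℝ S := by
  by_contra hcon
  obtain ⟨f, b, hf, hb⟩ := geometric_hahn_banach_closed_point (convex_convexHull ℝ S)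
    (hS.isClosed_convexHull ℝ) hcon
  obtain ⟨w, rfl⟩ := (InnerProductSpace.toDual ℝ ℂ).surjective f
  simp only [InnerProductSpace.toDual_apply_apply] at hf hb
  by_cases hw : w = 0
  · obtain ⟨y, hy, -⟩ := h (c + R) (by simp [abs_of_pos hR])
    have := hf y (subset_convexHull ℝ S hy)
    simp only [hw, inner_zero_left] at this hb
    linarith
  have hw0 : 0 < ‖w‖ := norm_pos_iff.2 hw
  obtain ⟨y, hy, hxy⟩ := h (c + (R * ‖w‖⁻¹) • w) (by
    rw [add_sub_cancel_left, norm_smul, norm_mul, norm_inv, norm_norm, mul_assoc,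
      inv_mul_cancel₀ hw0.ne', mul_one, Real.norm_of_nonneg hR.le])
  have h1 := hf y (subset_convexHull ℝ S hy)
  have h2 : inner ℝ w (c + (R * ‖w‖⁻¹) • w) = inner ℝ w c + R * ‖w‖ := by
    rw [inner_add_right, real_inner_smul_right, real_inner_self_eq_norm_sq]
    field_simp
  have h3 := real_inner_le_norm w (c + (R * ‖w‖⁻¹) • w - y)
  rw [inner_sub_right, h2] at h3
  have h4 := real_inner_le_norm w (s - c)
  rw [inner_sub_right] at h4
  nlinarith [mul_le_mul_of_nonneg_left hxy hw0.le, mul_lt_mul_of_pos_left hs hw0]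

end Gap

/-! ### The automorphism of the disk that moves the center to `s` -/

/-- The conformal map from the unit disk onto the disk of center `c` and radius `R` that maps the
origin to `s`. -/
noncomputable def diskMap (c s : ℂ) (R : ℝ) (u : ℂ) : ℂ :=
  s + (R ^ 2 - ‖c - s‖ ^ 2 : ℝ) * u / (R - starRingEnd ℂ (c - s) * u)

section DiskMap

variable {c s : ℂ} {R : ℝ}

theorem diskMap_zero : diskMap c s R 0 = s := by simp [diskMap]

theorem diskMap_denom_ne_zero (hs : ‖c - s‖ < R) {u : ℂ} (hu : ‖u‖ ≤ 1) :
    (R : ℂ) - starRingEnd ℂ (c - s) * u ≠ 0 := fun h => by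
  have h1 := congrArg norm (sub_eq_zero.1 h)
  rw [norm_mul, Complex.norm_conj, Complex.norm_real,
    Real.norm_of_nonneg ((norm_nonneg _).trans hs.le)] at h1
  nlinarith [norm_nonneg (c - s)]

theorem differentiableAt_diskMap (hs : ‖c - s‖ < R) {u : ℂ} (hu : ‖u‖ ≤ 1) :
    DifferentiableAt ℂ (diskMap c s R) u := by
  have := diskMap_denom_ne_zero hs hu
  unfold diskMap
  fun_prop (disch := assumption)

theorem diskMap_sub_center (hs : ‖c - s‖ < R) {u : ℂ} (hu : ‖u‖ ≤ 1) :
    diskMap c s R u - c = R * (R * u - (c - s)) / (R - starRingEnd ℂ (c - s) * u) := by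
  have h0 := diskMap_denom_ne_zero hs hu
  have h1 : ((‖c - s‖ ^ 2 : ℝ) : ℂ) = (c - s) * starRingEnd ℂ (c - s) := by
    rw [Complex.mul_conj, Complex.normSq_eq_norm_sq]
  rw [eq_div_iff h0, diskMap, Complex.ofReal_sub, h1]
  field_simp
  push_cast
  ring

/-- Compares the denominator and numerator in `diskMap_sub_center`: the sign of `1 - ‖u‖ ^ 2`
decides whether the image is inside or on the circle. -/
theorem norm_sq_sub_norm_sq (d u : ℂ) (R : ℝ) :
    ‖(R : ℂ) - starRingEnd ℂ d * u‖ ^ 2 - ‖R * u - d‖ ^ 2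
      = (R ^ 2 - ‖d‖ ^ 2) * (1 - ‖u‖ ^ 2) := by
  simp only [← Complex.normSq_eq_norm_sq, Complex.normSq_apply]
  simp
  ring

theorem norm_diskMap_sub_center (hs : ‖c - s‖ < R) {u : ℂ} (hu : ‖u‖ = 1) :
    ‖diskMap c s R u - c‖ = R := by
  have hR : 0 < R := (norm_nonneg _).trans_lt hs
  have h0 := diskMap_denom_ne_zero hs hu.le
  have h1 := norm_sq_sub_norm_sq (c - s) u R
  rw [hu, one_pow, sub_self, mul_zero, sub_eq_zero,
    sq_eq_sq₀ (norm_nonneg _) (norm_nonneg _)] at h1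
  rw [diskMap_sub_center hs hu.le, norm_div, norm_mul, ← h1, mul_div_cancel_right₀ _
    (norm_ne_zero_iff.2 h0), Complex.norm_real, Real.norm_of_nonneg hR.le]

theorem norm_diskMap_sub_center_lt (hs : ‖c - s‖ < R) {u : ℂ} (hu : ‖u‖ < 1) :
    ‖diskMap c s R u - c‖ < R := by
  have hR : 0 < R := (norm_nonneg _).trans_lt hs
  have h0 := diskMap_denom_ne_zero hs hu.le
  have h1 := norm_sq_sub_norm_sq (c - s) u R
  have h2 : 0 < (R ^ 2 - ‖c - s‖ ^ 2) * (1 - ‖u‖ ^ 2) :=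
    mul_pos (by nlinarith [norm_nonneg (c - s)]) (by nlinarith [norm_nonneg u])
  rw [diskMap_sub_center hs hu.le, norm_div, norm_mul, Complex.norm_real,
    Real.norm_of_nonneg hR.le, div_lt_iff₀ (norm_pos_iff.2 h0)]
  refine mul_lt_mul_of_pos_left (lt_of_pow_lt_pow_left₀ 2 (norm_nonneg _) ?_) hR
  linarith

/-- On the unit circle, `diskMap` followed by inversion is a similarity, so `u` is the outer normal
of the inverted circle at the image of `u`. -/
theorem invert_diskMap (hs : ‖c - s‖ < R) {u : ℂ} (hu : ‖u‖ = 1) :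
    invert s (diskMap c s R u) = (R ^ 2 - ‖c - s‖ ^ 2)⁻¹ • (R • u - (c - s)) := by
  have hD : R ^ 2 - ‖c - s‖ ^ 2 ≠ 0 := by nlinarith [norm_nonneg (c - s)]
  have hD' : ((R ^ 2 - ‖c - s‖ ^ 2 : ℝ) : ℂ) ≠ 0 := Complex.ofReal_ne_zero.2 hD
  have h0 := diskMap_denom_ne_zero hs hu.le
  have hu0 := ne_zero_of_norm_eq_one hu
  have hconj : starRingEnd ℂ u = u⁻¹ := by
    rw [Complex.inv_def, Complex.normSq_eq_norm_sq, hu]; simp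
  rw [invert_eq, diskMap, add_sub_cancel_left, map_div₀, map_mul, Complex.conj_ofReal, inv_div,
    map_sub, map_mul, Complex.conj_conj, Complex.conj_ofReal, hconj, Complex.real_smul,
    Complex.real_smul, Complex.ofReal_inv]
  field_simp

theorem norm_sub_le_of_mem_sphere {y : ℂ} (hy : ‖y - c‖ = R) :
    R - ‖c - s‖ ≤ ‖y - s‖ ∧ ‖y - s‖ ≤ R + ‖c - s‖ := by
  rw [← hy]
  constructor
  · have := norm_sub_le (y - s) (c - s)
    rw [sub_sub_sub_cancel_right] at this; linarith
  · have := norm_add_le (y - c) (c - s)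
    rwa [sub_add_sub_cancel] at this

theorem norm_sq_invert_of_mem_sphere (hs : ‖c - s‖ < R) {y : ℂ} (hy : ‖y - c‖ = R) :
    (R ^ 2 - ‖c - s‖ ^ 2) * ‖invert s y‖ ^ 2 + 2 * inner ℝ (c - s) (invert s y) = 1 := by
  have h0 : 0 < ‖y - s‖ := (sub_pos.2 hs).trans_le (norm_sub_le_of_mem_sphere hy).1
  have h1 : ‖(y - s) - (c - s)‖ ^ 2 = R ^ 2 := by rw [sub_sub_sub_cancel_right, hy]
  rw [norm_sub_sq_real, real_inner_comm] at h1
  rw [inner_invert, norm_invert]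
  field_simp
  linarith

/-- The inversion about `s` maps the nearest sample in the sense of normal directions to the nearest
sample of the inverted circle. -/
theorem norm_diskMap_sub_le {n : ℕ} {p : Fin n → ℂ} (hs : ‖c - s‖ < R)
    (hp : ∀ i, ‖p i - c‖ = R) {i j : Fin n} {u : ℂ}
    (hu : u ∈ unitNormals (fun j => invert s (p j)) i) :
    ‖diskMap c s R u - p i‖ ≤
      (R + ‖c - s‖) / (R - ‖c - s‖) * ‖diskMap c s R u - p j‖ := by
  have hR : 0 < R := (norm_nonneg _).trans_lt hs
  have hD : 0 < R ^ 2 - ‖c - s‖ ^ 2 := by nlinarith [norm_nonneg (c - s)]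
  -- On the inverted circle `‖Q k‖ ^ 2` is affine in `Q k`, so the squared distance decreases in
  -- `⟪u, Q k⟫`: the farthest point in direction `u` is the nearest to the image of `u`.
  have key : ∀ k, ‖invert s (diskMap c s R u) - invert s (p k)‖ ^ 2 =
      ‖invert s (diskMap c s R u)‖ ^ 2 +
        (R ^ 2 - ‖c - s‖ ^ 2)⁻¹ * (1 - 2 * R * inner ℝ u (invert s (p k))) := fun k => by
    have h1 := norm_sq_invert_of_mem_sphere hs (hp k)
    rw [norm_sub_sq_real]
    nth_rewrite 2 [invert_diskMap hs hu.1]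
    rw [real_inner_smul_left, inner_sub_left, real_inner_smul_left]
    field_simp
    linarith
  have h2 : ‖invert s (diskMap c s R u) - invert s (p i)‖ ≤
      ‖invert s (diskMap c s R u) - invert s (p j)‖ := by
    refine le_of_sq_le_sq ?_ (norm_nonneg _)
    rw [key, key]
    gcongr
    exact hu.2 j
  have hne : ∀ y : ℂ, ‖y - c‖ = R → 0 < ‖y - s‖ := fun y hy =>
    (sub_pos.2 hs).trans_le (norm_sub_le_of_mem_sphere hy).1
  have hg := norm_diskMap_sub_center hs hu.1
  have hne' : ∀ y : ℂ, ‖y - c‖ = R → y ≠ s := fun y hy h => by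
    have := hne y hy; rw [h, sub_self, norm_zero] at this; exact lt_irrefl _ this
  -- Back on the original circle, distances to `p k` change by a factor involving `‖p k - s‖`, which
  -- lies between `R - ‖c - s‖` and `R + ‖c - s‖`.
  rw [invert_sub_invert (hne' _ hg) (hne' _ (hp i)), invert_sub_invert (hne' _ hg) (hne' _ (hp j)),
    ← div_div, ← div_div, div_right_comm, div_right_comm _ _ ‖p j - s‖,
    div_le_div_iff_of_pos_right (hne _ hg), div_le_iff₀ (hne _ (hp i))] at h2
  refine h2.trans ?_
  rw [div_mul_eq_mul_div, div_mul_eq_mul_div, mul_comm]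
  have h3 := (norm_sub_le_of_mem_sphere (s := s) (hp i)).2
  have h4 := (norm_sub_le_of_mem_sphere (s := s) (hp j)).1
  have h5 := sub_pos.2 hs
  gcongr

theorem norm_sub_le_diskMap (hs : ‖c - s‖ < R) {u v : ℂ} (hu : ‖u‖ = 1) (hv : ‖v‖ = 1) :
    ‖u - v‖ ≤ (R ^ 2 - ‖c - s‖ ^ 2) / (R * (R - ‖c - s‖) ^ 2) *
      ‖diskMap c s R u - diskMap c s R v‖ := by
  have hR : 0 < R := (norm_nonneg _).trans_lt hs
  have hD : 0 < R ^ 2 - ‖c - s‖ ^ 2 := by nlinarith [norm_nonneg (c - s)]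
  have hm := sub_pos.2 hs
  have h1 := (norm_sub_le_of_mem_sphere (s := s) (norm_diskMap_sub_center hs hu)).1
  have h2 := (norm_sub_le_of_mem_sphere (s := s) (norm_diskMap_sub_center hs hv)).1
  have hne : ∀ y : ℂ, R - ‖c - s‖ ≤ ‖y - s‖ → y ≠ s := fun y hy h => by
    rw [h, sub_self, norm_zero] at hy; linarith
  have h3 := invert_sub_invert (hne _ h1) (hne _ h2)
  rw [invert_diskMap hs hu, invert_diskMap hs hv, ← smul_sub, sub_sub_sub_cancel_right, ← smul_sub,
    norm_smul, norm_smul, Real.norm_of_nonneg hR.le, norm_inv, Real.norm_of_nonneg hD.le] at h3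
  have h4 : ‖diskMap c s R u - diskMap c s R v‖ /
      (‖diskMap c s R u - s‖ * ‖diskMap c s R v - s‖) ≤
      ‖diskMap c s R u - diskMap c s R v‖ / (R - ‖c - s‖) ^ 2 := by
    rw [sq]; gcongr
  rw [← h3] at h4
  calc ‖u - v‖ = (R ^ 2 - ‖c - s‖ ^ 2) / R * ((R ^ 2 - ‖c - s‖ ^ 2)⁻¹ * (R * ‖u - v‖)) := by
        field_simp
    _ ≤ (R ^ 2 - ‖c - s‖ ^ 2) / R *
        (‖diskMap c s R u - diskMap c s R v‖ / (R - ‖c - s‖) ^ 2) := by gcongr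
    _ = _ := by field_simp

/-- The mean value property, transported by the disk automorphism. -/
theorem circleAverage_comp_diskMap {E : Type*} [NormedAddCommGroup E] [NormedSpace ℝ E]
    [CompleteSpace E]
    (hs : ‖c - s‖ < R) {f : ℂ → E} (hf : InnerProductSpace.HarmonicContOnCl f (Metric.ball c R)) :
    Real.circleAverage (f ∘ diskMap c s R) 0 1 = f s := by
  have hmaps : MapsTo (diskMap c s R) (Metric.closedBall 0 1) (Metric.closedBall c R) := by
    intro u hu
    rw [mem_closedBall_zero_iff] at hu
    rw [mem_closedBall_iff_norm]
    rcases hu.lt_or_eq with h | h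
    · exact (norm_diskMap_sub_center_lt hs h).le
    · exact (norm_diskMap_sub_center hs h).le
  have hcont : ContinuousOn (diskMap c s R) (Metric.closedBall 0 1) := fun u hu =>
    (differentiableAt_diskMap hs (mem_closedBall_zero_iff.1 hu)).continuousAt.continuousWithinAt
  have han : AnalyticOnNhd ℂ (diskMap c s R) (Metric.ball 0 1) := by
    refine DifferentiableOn.analyticOnNhd (fun u hu => ?_) Metric.isOpen_ball
    exact (differentiableAt_diskMap hs (mem_ball_zero_iff.1 hu).le).differentiableWithinAt
  have hmapsb : MapsTo (diskMap c s R) (Metric.ball 0 1) (Metric.ball c R) := fun u hu => by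
    rw [mem_ball_iff_norm]
    exact norm_diskMap_sub_center_lt hs (mem_ball_zero_iff.1 hu)
  have hfc := hf.continuousOn_ball.comp hcont hmaps
  -- Real functionals reduce to real-valued functions, which are real parts of analytic functions on
  -- the disk; composing those with `diskMap` preserves harmonicity.
  rw [SeparatingDual.eq_iff_forall_dual_eq (R := ℝ)]
  intro g
  rw [← g.circleAverage_comp_comm (ContinuousOn.circleIntegrable'
    (hfc.mono (by rw [abs_one]; exact Metric.sphere_subset_closedBall)))]
  obtain ⟨F, hF, hFe⟩ :=
    InnerProductSpace.HarmonicOnNhd.exists_analyticOnNhd_ball_re_eq (hf.harmonicOnNhd.comp_CLM g)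
  have hharm : InnerProductSpace.HarmonicContOnCl (g ∘ f ∘ diskMap c s R) (Metric.ball 0 |1|) := by
    rw [abs_one]
    refine InnerProductSpace.HarmonicContOnCl.mk_ball (fun u hu => ?_)
      (g.continuous.comp_continuousOn hfc)
    refine (InnerProductSpace.harmonicAt_congr_nhds ?_).1
      ((hF _ (hmapsb hu)).comp (han u hu)).harmonicAt_re
    filter_upwards [Metric.isOpen_ball.mem_nhds hu] with v hv using hFe (hmapsb hv)
  rw [hharm.circleAverage_eq]
  simp [diskMap_zero]

end DiskMap

/-! ### The Riemann sum -/

theorem exists_tan_le {η : ℝ} (hη : 0 < η) :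
    ∃ x₀ > 0, ∀ x, 0 ≤ x → x ≤ x₀ → Real.tan x ≤ (1 + η) * x := by
  have h := (Real.hasDerivAt_tan (x := 0) (by simp)).isLittleO.bound hη
  obtain ⟨r, hr, hr'⟩ := Metric.eventually_nhds_iff.1 h
  refine ⟨r / 2, half_pos hr, fun x hx0 hx => ?_⟩
  have h1 := hr' (y := x) (by rw [Real.dist_eq, sub_zero, abs_of_nonneg hx0]; linarith)
  simp only [Real.tan_zero, sub_zero, Real.cos_zero, one_pow, div_one, smul_eq_mul, mul_one,
    Real.norm_eq_abs, abs_of_nonneg hx0] at h1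
  linarith [le_abs_self (Real.tan x - x)]

section Riemann

variable {𝕜 : Type*} [RCLike 𝕜]

theorem intervalIntegrable_normalInd_smul {ι : Type*} (Q : ι → ℂ) (i : ι) (w : 𝕜) (a b : ℝ) :
    IntervalIntegrable (fun t => normalInd Q i t • w) volume a b :=
  ⟨(intervalIntegrable_normalInd Q i a b).1.smul_const w,
    (intervalIntegrable_normalInd Q i a b).2.smul_const w⟩

/-- Writing each angle as the integral of its indicator makes the difference an integral of `∑
normalInd Q i t • (z i - H t)`, almost everywhere a convex combination of errors at most `η`. -/
theorem norm_sum_extAngle_smul_sub_le {ι : Type*} [Fintype ι] [Nonempty ι] {Q : ι → ℂ}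
    (hQ : Function.Injective Q) (hπ : ∀ i, extAngle Q i < π) {z : ι → 𝕜} {H : ℝ → 𝕜}
    (hH : Continuous H) {η : ℝ}
    (h : ∀ i t, dir t ∈ normalCone Q i → ‖z i - H t‖ ≤ η) :
    ‖∑ i, extAngle Q i • z i - ∫ t in (0)..(2 * π), H t‖ ≤ 2 * π * η := by
  have h1 : ∑ i, extAngle Q i • z i = ∫ t in (0)..(2 * π), ∑ i, normalInd Q i t • z i := by
    rw [intervalIntegral.integral_finsetSum]
    · refine Finset.sum_congr rfl fun i _ => ?_
      rw [intervalIntegral.integral_smul_const, integral_normalInd (hπ i)]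
    · exact fun i _ => intervalIntegrable_normalInd_smul Q i (z i) _ _
  have h2 : IntervalIntegrable (fun t => ∑ i, normalInd Q i t • z i) volume 0 (2 * π) := by
    simpa only [Finset.sum_fn] using IntervalIntegrable.sum Finset.univ (f := fun i t =>
      normalInd Q i t • z i) fun i _ => intervalIntegrable_normalInd_smul Q i (z i) _ _
  rw [h1, ← intervalIntegral.integral_sub h2 (hH.intervalIntegrable _ _)]
  have h3 := intervalIntegral.norm_integral_le_of_norm_le_const_ae (a := 0) (b := 2 * π)
    (f := fun t => ∑ i, normalInd Q i t • z i - H t) (C := η) ?_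
  · rw [sub_zero, abs_of_pos Real.two_pi_pos] at h3
    linarith
  · filter_upwards [sum_normalInd_ae hQ] with t ht _
    have e : ∑ i, normalInd Q i t • z i - H t = ∑ i, normalInd Q i t • (z i - H t) := by
      simp only [smul_sub, Finset.sum_sub_distrib, ← Finset.sum_smul, ht, one_smul]
    rw [e]
    calc ‖∑ i, normalInd Q i t • (z i - H t)‖ ≤ ∑ i, normalInd Q i t * η := by
          refine norm_sum_le_of_le _ fun i _ => ?_
          rw [norm_smul, Real.norm_of_nonneg (normalInd_nonneg Q i t)]
          by_cases hd : dir t ∈ normalCone Q i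
          · exact mul_le_mul_of_nonneg_left (h i t hd) (normalInd_nonneg Q i t)
          · simp [normalInd, hd]
      _ = η := by rw [← Finset.sum_mul, ht, one_mul]

/-- Split `tan (θ_i / 2)` into `θ_i / 2` and the excess. After division by `W ≥ π` these contribute
at most `η'` and `η * B`. -/
theorem norm_neighborAverage_sub_le {n : ℕ} [Nonempty (Fin n)] {p : Fin n → ℂ} {z : Fin n → 𝕜}
    {s : ℂ} {a : 𝕜} {η η' B : ℝ} (hp : Function.Injective p) (hsp : s ∉ range p)
    (hπ : ∀ i, luneAngle p s i < π)
    (hT : ∀ i, Real.tan (luneAngle p s i / 2) ≤ (1 + η) * (luneAngle p s i / 2))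
    (hη : 0 ≤ η) (hB : ∀ i, ‖z i - a‖ ≤ B)
    (hsum : ‖∑ i, luneAngle p s i • (z i - a)‖ ≤ 2 * π * η') :
    ‖neighborAverage p z s - a‖ ≤ η' + η * B := by
  have hW := pi_le_totalWeight hp hsp hπ
  have hW0 : 0 < totalWeight p s := Real.pi_pos.trans_le hW
  have hsumθ := sum_luneAngle hp hsp hπ
  have e1 : neighborAverage p z s - a =
      (totalWeight p s)⁻¹ • ∑ i, Real.tan (luneAngle p s i / 2) • (z i - a) := by
    have h1 : (totalWeight p s)⁻¹ • ∑ i, Real.tan (luneAngle p s i / 2) • a = a := by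
      rw [← Finset.sum_smul, ← totalWeight_eq, smul_smul, inv_mul_cancel₀ hW0.ne', one_smul]
    simp only [smul_sub, Finset.sum_sub_distrib, h1, neighborAverage_eq]
    simp only [weight, Finset.smul_sum, smul_smul, div_eq_inv_mul]
  have e2 : ∑ i, Real.tan (luneAngle p s i / 2) • (z i - a) =
      (1 / 2 : ℝ) • ∑ i, luneAngle p s i • (z i - a) +
        ∑ i, (Real.tan (luneAngle p s i / 2) - luneAngle p s i / 2) • (z i - a) := by
    rw [Finset.smul_sum, ← Finset.sum_add_distrib]
    refine Finset.sum_congr rfl fun i _ => ?_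
    rw [smul_smul, ← add_smul]
    congr 1; ring
  have b2 : ‖∑ i, (Real.tan (luneAngle p s i / 2) - luneAngle p s i / 2) • (z i - a)‖ ≤
      π * (η * B) := by
    calc _ ≤ ∑ i, luneAngle p s i * (η / 2 * B) := by
          refine norm_sum_le_of_le _ fun i _ => ?_
          have h0 := luneAngle_nonneg p s i
          have h1 : 0 ≤ Real.tan (luneAngle p s i / 2) - luneAngle p s i / 2 :=
            sub_nonneg.2 (Real.le_tan (by linarith) (by linarith [hπ i]))
          rw [norm_smul, Real.norm_of_nonneg h1]
          calc _ ≤ (η * (luneAngle p s i / 2)) * B :=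
                mul_le_mul (by linarith [hT i]) (hB i) (norm_nonneg _) (by positivity)
            _ = _ := by ring
      _ = π * (η * B) := by rw [← Finset.sum_mul, hsumθ]; ring
  have b : ‖∑ i, Real.tan (luneAngle p s i / 2) • (z i - a)‖ ≤ π * (η' + η * B) := by
    rw [e2]
    refine (norm_add_le _ _).trans ?_
    rw [norm_smul, Real.norm_of_nonneg (by norm_num : (0 : ℝ) ≤ 1 / 2)]
    linarith
  rw [e1, norm_smul, norm_inv, Real.norm_of_nonneg hW0.le, inv_mul_le_iff₀ hW0]
  have h0 : 0 ≤ η' + η * B := by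
    have := (norm_nonneg _).trans b
    exact nonneg_of_mul_nonneg_right this Real.pi_pos
  exact b.trans (mul_le_mul_of_nonneg_right hW h0)

theorem continuous_comp_diskMap_dir {c s : ℂ} {R : ℝ} (hs : ‖c - s‖ < R) {f : ℂ → 𝕜}
    (hf : ContinuousOn f (Metric.closedBall c R)) :
    Continuous fun t => f (diskMap c s R (dir t)) := by
  have h1 : Continuous fun t => diskMap c s R (dir t) := continuous_iff_continuousAt.2 fun t =>
    ((differentiableAt_diskMap hs (norm_dir t).le).continuousAt).comp continuous_dir.continuousAt
  exact hf.comp_continuous h1 fun t =>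
    mem_closedBall_iff_norm.2 (norm_diskMap_sub_center hs (norm_dir t)).le

theorem integral_comp_diskMap {c s : ℂ} {R : ℝ} (hs : ‖c - s‖ < R) {f : ℂ → 𝕜}
    (hf : InnerProductSpace.HarmonicContOnCl f (Metric.ball c R)) :
    ∫ t in (0)..(2 * π), f (diskMap c s R (dir t)) = (2 * π) • f s := by
  rw [← circleAverage_comp_diskMap hs hf, Real.circleAverage, smul_smul,
    mul_inv_cancel₀ Real.two_pi_pos.ne', one_smul]
  simp [circleMap, dir]

/-- Reconstruction of a harmonic function from dense samples on a circle. -/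
theorem interpolant_harmonic {c : ℂ} {R : ℝ} (hR : 0 < R) {f : ℂ → 𝕜}
    (hf : InnerProductSpace.HarmonicContOnCl f (Metric.ball c R)) {s : ℂ}
    (hsc : s ∈ Metric.ball c R) {δ : ℝ} (hδ : 0 < δ) :
    ∃ ε : ℝ, 0 < ε ∧ ∀ (n : ℕ) (p : Fin n → ℂ), 0 < n → Function.Injective p →
      (∀ i, p i ∈ Metric.sphere c R) → maxGap c p < ε →
        s ∈ convexHull ℝ (range p) ∧ ‖interpolant p (fun i => f (p i)) s - f s‖ < δ := by
  have hs' : ‖s - c‖ < R := mem_ball_iff_norm.1 hsc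
  have hs : ‖c - s‖ < R := by rwa [norm_sub_rev]
  have hfc := hf.continuousOn_ball
  have hK := isCompact_closedBall c R
  obtain ⟨B, hB⟩ := hK.exists_bound_of_continuousOn (f := fun x => f x - f s)
    (hfc.sub continuousOn_const)
  have hB0 : 0 ≤ B := (norm_nonneg _).trans (hB s (Metric.ball_subset_closedBall hsc))
  obtain ⟨ρ, hρ, hfρ⟩ := Metric.uniformContinuousOn_iff_le.1
    (hK.uniformContinuousOn_of_continuous hfc) (δ / 4) (by positivity)
  -- The excess of the tangents then costs at most `δ / 4`, like the Riemann sum; `B + 1` allows `B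
  -- = 0`.
  obtain ⟨x₀, hx₀, htan⟩ := exists_tan_le (η := δ / (4 * (B + 1))) (by positivity)
  set κ := (R + ‖c - s‖) / (R - ‖c - s‖) with hκ
  set L := (R ^ 2 - ‖c - s‖ ^ 2) / (R * (R - ‖c - s‖) ^ 2) with hL
  have hm := sub_pos.2 hs
  have hκ0 : 0 < κ := div_pos (by linarith [norm_nonneg (c - s)]) hm
  have hL0 : 0 < L := div_pos (by nlinarith [norm_nonneg (c - s)]) (by positivity)
  -- The four bounds put `s` in the hull, bring sample values within `δ / 4` by uniform continuity,
  -- keep the angles below `π`, and make the half-angles small enough for `htan`.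
  obtain ⟨ε, ⟨⟨hε1, hε2⟩, hε3, hε4⟩, hε⟩ : ∃ ε : ℝ, ((‖s - c‖ + R * ε < R ∧ κ * (R * ε) < ρ) ∧
      π / 2 * (L * (2 * (κ * (R * ε)))) < π ∧ π / 2 * (L * (2 * (κ * (R * ε)))) < 2 * x₀) ∧
      0 < ε := by
    have hlim : ∀ F : ℝ → ℝ, Continuous F → ∀ b, F 0 < b → ∀ᶠ ε in 𝓝[>] (0 : ℝ), F ε < b :=
      fun F hF b hb => (hF.continuousAt.eventually_lt_const hb).filter_mono nhdsWithin_le_nhds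
    exact ((((hlim (fun ε => ‖s - c‖ + R * ε) (by fun_prop) R (by simpa using hs')).and
      (hlim (fun ε => κ * (R * ε)) (by fun_prop) ρ (by simpa using hρ))).and
      ((hlim (fun ε => π / 2 * (L * (2 * (κ * (R * ε))))) (by fun_prop) π
        (by simpa using Real.pi_pos)).and
      (hlim (fun ε => π / 2 * (L * (2 * (κ * (R * ε))))) (by fun_prop) (2 * x₀)
        (by simpa using hx₀)))).and self_mem_nhdsWithin).exists
  refine ⟨ε, hε, fun n p hn hp hpC hgap => ?_⟩
  have : Nonempty (Fin n) := ⟨⟨0, hn⟩⟩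
  have hpc : ∀ i, ‖p i - c‖ = R := fun i => mem_sphere_iff_norm.1 (hpC i)
  have hdense : ∀ x, ‖x - c‖ = R → ∃ j, ‖x - p j‖ ≤ R * ε := fun x hx =>
    exists_norm_sub_le_of_maxGap hR hpc hgap hx
  have hsp : s ∉ range p := by
    rintro ⟨i, rfl⟩
    exact hs'.ne (hpc i)
  refine ⟨mem_convexHull_of_dense (finite_range p) hR hε1 fun x hx => ?_, ?_⟩
  · obtain ⟨j, hj⟩ := hdense x hx
    exact ⟨p j, ⟨j, rfl⟩, hj⟩
  have hclose : ∀ i, ∀ u ∈ unitNormals (fun j => invert s (p j)) i,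
      ‖diskMap c s R u - p i‖ ≤ κ * (R * ε) := fun i u hu => by
    obtain ⟨j, hj⟩ := hdense _ (norm_diskMap_sub_center hs hu.1)
    exact (norm_diskMap_sub_le hs hpc hu).trans (mul_le_mul_of_nonneg_left hj hκ0.le)
  -- Two normals at one sample have `diskMap` images near that sample, hence near each other; `L`
  -- converts this into a chord of the unit circle, and an angle is at most `π / 2` times its chord.
  have hθ : ∀ i, extAngle (fun j => invert s (p j)) i ≤ π / 2 * (L * (2 * (κ * (R * ε)))) := by
    refine fun i => extAngle_le (by positivity) fun u hu v hv => ?_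
    refine (Complex.angle_le_mul_norm_sub hu.1 hv.1).trans ?_
    refine mul_le_mul_of_nonneg_left ((norm_sub_le_diskMap hs hu.1 hv.1).trans ?_) (by positivity)
    refine mul_le_mul_of_nonneg_left ?_ hL0.le
    have := norm_sub_le (diskMap c s R u - p i) (diskMap c s R v - p i)
    rw [sub_sub_sub_cancel_right] at this
    linarith [hclose i u hu, hclose i v hv]
  have hπ : ∀ i, extAngle (fun j => invert s (p j)) i < π := fun i => (hθ i).trans_lt hε3
  have hsum := norm_sum_extAngle_smul_sub_le (invert_injective hp hsp) hπ
    (z := fun i => f (p i)) (continuous_comp_diskMap_dir hs hfc) (η := δ / 4) (fun i t ht => by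
      have h1 := hclose i _ ⟨norm_dir t, ht⟩
      rw [← dist_eq_norm]
      refine hfρ _ (Metric.sphere_subset_closedBall (hpC i)) _
        (mem_closedBall_iff_norm.2 (norm_diskMap_sub_center hs (norm_dir t)).le) ?_
      rw [dist_comm, dist_eq_norm]
      exact h1.trans hε2.le)
  rw [integral_comp_diskMap hs hf] at hsum
  simp only [← luneAngle_eq hsp] at hsum hπ hθ
  rw [← sum_luneAngle hp hsp hπ, Finset.sum_smul, ← Finset.sum_sub_distrib] at hsum
  simp only [← smul_sub] at hsum
  rw [sum_luneAngle hp hsp hπ] at hsum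
  rw [interpolant_of_notMem _ hsp]
  have hfin := norm_neighborAverage_sub_le (z := fun i => f (p i)) (a := f s) (B := B) hp hsp hπ
    (fun i => htan _ (by linarith [luneAngle_nonneg p s i]) (by linarith [hθ i]))
    (by positivity) (fun i => hB _ (Metric.sphere_subset_closedBall (hpC i))) hsum
  refine hfin.trans_lt ?_
  have : δ / (4 * (B + 1)) * B ≤ δ / 4 := by
    rw [div_mul_eq_mul_div, div_le_div_iff₀ (by positivity) (by norm_num)]
    nlinarith
  linarith

end Riemann

end MobiusInterp

theorem mainTheorem1 {𝕜 : Type*} [RCLike 𝕜] :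
    -- continuity on the convex hull and interpolation of the elevations
    (∀ (n : ℕ) (p : Fin n → ℂ) (z : Fin n → 𝕜), Function.Injective p →
      ¬ Collinear ℝ (Set.range p) →
        -- the weights are well defined at every non-sample point of the hull
        (∀ s ∈ convexHull ℝ (Set.range p) \ Set.range p,
          (∀ i, 0 ≤ MobiusInterp.luneAngle p s i ∧ MobiusInterp.luneAngle p s i < Real.pi) ∧
          0 < MobiusInterp.totalWeight p s) ∧
        ContinuousOn (MobiusInterp.interpolant p z) (convexHull ℝ (Set.range p)) ∧
        ∀ i, MobiusInterp.interpolant p z (p i) = z i ∧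
          Filter.Tendsto (MobiusInterp.neighborAverage p z)
            (nhdsWithin (p i) (convexHull ℝ (Set.range p) \ Set.range p)) (nhds (z i))) ∧
    -- reconstruction of harmonic functions in the limit of dense samples on a circle
    (∀ (c : ℂ) (R : ℝ), 0 < R → ∀ f : ℂ → 𝕜,
      InnerProductSpace.HarmonicContOnCl f (Metric.ball c R) →
      ∀ s ∈ Metric.ball c R, ∀ δ : ℝ, 0 < δ → ∃ ε : ℝ, 0 < ε ∧
        ∀ (n : ℕ) (p : Fin n → ℂ), 0 < n → Function.Injective p →
          (∀ i, p i ∈ Metric.sphere c R) → MobiusInterp.maxGap c p < ε →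
            s ∈ convexHull ℝ (Set.range p) ∧
            ‖MobiusInterp.interpolant p (fun i => f (p i)) s - f s‖ < δ) := by
  refine ⟨fun n p z hp hcol => ⟨fun s hs => ?_, MobiusInterp.continuousOn_interpolant z hp hcol,
    fun i => ⟨MobiusInterp.interpolant_apply hp z i,
      MobiusInterp.tendsto_neighborAverage_sample z hp hcol i⟩⟩,
    fun c R hR f hf s hs δ hδ => MobiusInterp.interpolant_harmonic hR hf hs hδ⟩
  have : Nonempty (Fin n) := MobiusInterp.nonempty_of_mem_convexHull hs.1
  have hlt := MobiusInterp.luneAngle_lt_pi hcol hs.1 hs.2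
  exact ⟨fun i => ⟨MobiusInterp.luneAngle_nonneg p s i, hlt i⟩,
    Real.pi_pos.trans_le (MobiusInterp.pi_le_totalWeight hp hs.2 hlt)⟩
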